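/- Let $n\ge 1$ and let $B_n$ be the braid group on $n$ strands, with Artin generators $\sigma_1,\dots,\sigma_{n-1}$ and relations $\sigma_i\sigma_j=\sigma_j\sigma_i$ for $|i-j|>1$, $\sigma_i\sigma_j\sigma_i=\sigma_j\sigma_i\sigma_j$ for $|i-j|=1$. For $n\ge t>s\ge 1$ let $$a_{ts}=(\sigma_{t-1}\sigma_{t-2}\cdots\sigma_{s+1})\,\sigma_s\,(\sigma_{t-1}\sigma_{t-2}\cdots\sigma_{s+1})^{-1}$$ be the band generators, let $B_n^+\subseteq B_n$ be the submonoid of positive braids that they generate, and let $\delta=a_{n(n-1)}a_{(n-1)(n-2)}\cdots a_{21}$. Write $e$ for the identity of $B_n$. For a positive braid $P$ let $|P|$ be the length of any positive word in the band generators that represents $P$ (all these words have the same length). For $V,W\in B_n$ write $V\le W$ if $W=P_1VP_2$ with $P_1,P_2\in B_n^+$. A canonical factor is a braid $A$ with $e\le A\le\delta$. For a canonical factor $A$ and a positive braid $P$, write $A\lceil P$ (the decomposition $AP$ is left-weighted) if $|A|\ge|A'|$ for every canonical factor $A'$ and every positive braid $P'$ with $A'P'=AP$. Suppose that $A_{i-1},A_i,A_{i+1}$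 are canonical factors in $B_n$ with $A_{i-1}\lceil A_i$. Let $A_i',A_{i+1}'$ be canonical factors with $A_iA_{i+1}=A_i'A_{i+1}'$ and $A_i'\lceil A_{i+1}'$. Let $A_{i-1}',A_i''$ be canonical factors with $A_{i-1}A_i'=A_{i-1}'A_i''$ and $A_{i-1}'\lceil A_i''$. Then $A_i''\lceil A_{i+1}'$. -/

import Mathlib

namespace Braid

/-- Artin's relators: `σ_i σ_j = σ_j σ_i` for `|i - j| > 1` and
`σ_i σ_j σ_i = σ_j σ_i σ_j` for `|i - j| = 1`, where `1 ≤ i, j ≤ n - 1`. -/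
def artinRels (n : ℕ) : Set (FreeGroup {i : ℕ // 1 ≤ i ∧ i < n}) :=
  {r | ∃ i j : {i : ℕ // 1 ≤ i ∧ i < n},
    (1 < |((i : ℕ) : ℤ) - ((j : ℕ) : ℤ)| ∧
      r = (FreeGroup.of i * FreeGroup.of j) * (FreeGroup.of j * FreeGroup.of i)⁻¹) ∨
    (|((i : ℕ) : ℤ) - ((j : ℕ) : ℤ)| = 1 ∧
      r = (FreeGroup.of i * FreeGroup.of j * FreeGroup.of i) *
        (FreeGroup.of j * FreeGroup.of i * FreeGroup.of j)⁻¹)}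

/-- The braid group `B_n` on `n` strands, by Artin's presentation. -/
abbrev BraidGroup (n : ℕ) : Type := PresentedGroup (artinRels n)

/-- The Artin generator `σ_i` of `B_n`, for `1 ≤ i ≤ n - 1` (and `1` for other `i`, never used). -/
def sigma (n i : ℕ) : BraidGroup n :=
  if h : 1 ≤ i ∧ i < n then PresentedGroup.of ⟨i, h⟩ else 1

/-- The band generator
`a_{ts} = (σ_{t-1} σ_{t-2} ⋯ σ_{s+1}) σ_s (σ_{t-1} σ_{t-2} ⋯ σ_{s+1})⁻¹`, for `n ≥ t > s ≥ 1`. -/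
def band (n t s : ℕ) : BraidGroup n :=
  ((List.Ico (s + 1) t).reverse.map (sigma n)).prod * sigma n s *
    (((List.Ico (s + 1) t).reverse.map (sigma n)).prod)⁻¹

/-- The set of band generators `a_{ts}`, `n ≥ t > s ≥ 1`. -/
def bandGenerators (n : ℕ) : Set (BraidGroup n) :=
  {g | ∃ t s : ℕ, 1 ≤ s ∧ s < t ∧ t ≤ n ∧ g = band n t s}

/-- The monoid `B_n⁺ ⊆ B_n` of positive braids: the braids represented by positive words in the
band generators. -/
def positive (n : ℕ) : Submonoid (BraidGroup n) :=
  Submonoid.closure (bandGenerators n)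

/-- The fundamental braid `δ = a_{n(n-1)} a_{(n-1)(n-2)} ⋯ a_{21}`. -/
def delta (n : ℕ) : BraidGroup n :=
  ((List.Ico 1 n).reverse.map (fun i => band n (i + 1) i)).prod

/-- The relation `V ≤ W` on `B_n`: `W = P₁ V P₂` for some positive `P₁`, `P₂`. -/
def le {n : ℕ} (V W : BraidGroup n) : Prop :=
  ∃ P₁ ∈ positive n, ∃ P₂ ∈ positive n, W = P₁ * V * P₂

/-- Canonical factors: the braids `A` with `e ≤ A ≤ δ`. -/
def IsCanonicalFactor {n : ℕ} (A : BraidGroup n) : Prop :=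
  le 1 A ∧ le A (delta n)

/-- The word length `|P|` of a positive braid `P`: the length of the positive words in the band
generators that represent `P`. (All of these have the same length, so taking the least is only a
way of picking the common value.) -/
noncomputable def wordLength {n : ℕ} (P : BraidGroup n) : ℕ :=
  sInf {k | ∃ w : List (BraidGroup n), (∀ a ∈ w, a ∈ bandGenerators n) ∧ w.prod = P ∧ w.length = k}

/-- `A ⌈ P`: the decomposition `Q = A P`, with `A` a canonical factor and `P ≥ e`, is left-weighted,
that is, `|A|` is maximal among all decompositions of `Q` as a canonical factor times a
positive braid. -/
def LeftWeighted {n : ℕ} (A P : BraidGroup n) : Prop :=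
  IsCanonicalFactor A ∧ le 1 P ∧
    ∀ A' P' : BraidGroup n, IsCanonicalFactor A' → le 1 P' → A' * P' = A * P →
      wordLength A' ≤ wordLength A

end Braid

/-! Write A₀' = A₀c and A₁' = A₁d with c, d positive, so that A₂ = dA₂' and A₁d = cA₁''. Let S be a
positive left divisor of A₂' with A₁''S canonical. Then dS left-divides A₂, so it is canonical, and
dS and A₁''S both right-divide Z = A₁dS = cA₁''S. They have a canonical common left multiple L that
right-divides Z, say Z = uL. Cancelling, u left-divides both A₁ and c; hence A₀u left-divides A₀'
and is canonical, and A₀⌈A₁ forces u = 1. So A₁'S = L is canonical, and A₁'⌈A₂' forces S = 1. The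
criterion used throughout is `LeftWeighted.eq_one` with its converse `leftWeighted_of_forall`.

The deep input is that two canonical factors dividing a positive braid Z on one side have a
canonical common multiple dividing Z on that side. It comes from the dual Garside structure:
canonical factors are the lifts of noncrossing partitions, and for a ≤ b the quotient a⁻¹b is b ⊓
K(a), where K = `compl` is the Kreweras complement, K(a) = a⁻¹δ. Partitions act on left-weighted
sequences of partitions. Once a central power of δ is inverted they act by permutations, which
yields a representation of the whole group `BraidGroup n`. A positive braid applied to the empty
sequence gives a normal form depending only on the braid, and its first entry is the greatest
partition dividing the braid on the left (`exists_head`). Joins of left divisors therefore divide,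
and an anti-automorphism fixing δ transfers this to right divisors. -/

namespace Braid

/-! ### Noncrossing partitions and the Kreweras complement. -/

/-- Noncrossing equivalence relations on `{1, …, n}`, extended trivially to `ℕ`. -/
@[ext]
structure NC (n : ℕ) where
  rel : ℕ → ℕ → Prop
  refl (x : ℕ) : rel x x
  symm {x y : ℕ} : rel x y → rel y x
  trans {x y z : ℕ} : rel x y → rel y z → rel x z
  bdd {x y : ℕ} : rel x y → x ≠ y → 1 ≤ x ∧ x ≤ n
  noncrossing {x y z w : ℕ} : x < y → y < z → z < w → rel x z → rel y w → rel x y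

namespace NC

variable {n : ℕ}

instance : PartialOrder (NC n) where
  le a b := ∀ ⦃x y⦄, a.rel x y → b.rel x y
  le_refl _ _ _ h := h
  le_trans _ _ _ h h' _ _ r := h' (h r)
  le_antisymm a b h h' := by
    ext x y
    exact ⟨fun r => h r, fun r => h' r⟩

instance : SemilatticeInf (NC n) where
  inf a b :=
    { rel x y := a.rel x y ∧ b.rel x y
      refl x := ⟨a.refl x, b.refl x⟩
      symm h := ⟨a.symm h.1, b.symm h.2⟩
      trans h h' := ⟨a.trans h.1 h'.1, b.trans h.2 h'.2⟩
      bdd h := a.bdd h.1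
      noncrossing h₁ h₂ h₃ h h' :=
        ⟨a.noncrossing h₁ h₂ h₃ h.1 h'.1, b.noncrossing h₁ h₂ h₃ h.2 h'.2⟩ }
  inf_le_left _ _ _ _ h := h.1
  inf_le_right _ _ _ _ h := h.2
  le_inf _ _ _ h h' _ _ r := ⟨h r, h' r⟩

instance : OrderTop (NC n) where
  top :=
    { rel x y := x = y ∨ (1 ≤ x ∧ x ≤ n ∧ 1 ≤ y ∧ y ≤ n)
      refl x := by omega
      symm := by omega
      trans := by omega
      bdd := by omega
      noncrossing := by omega }
  le_top a x y h := by
    rcases eq_or_ne x y with rfl | hne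
    · exact Or.inl rfl
    · have h₁ := a.bdd h hne
      have h₂ := a.bdd (a.symm h) hne.symm
      exact Or.inr ⟨h₁.1, h₁.2, h₂.1, h₂.2⟩

instance : OrderBot (NC n) where
  bot :=
    { rel x y := x = y
      refl x := rfl
      symm := Eq.symm
      trans := Eq.trans
      bdd := by omega
      noncrossing := by omega }
  bot_le a x y h := by
    cases h
    exact a.refl x

theorem inf_rel {a b : NC n} {x y : ℕ} : (a ⊓ b).rel x y ↔ a.rel x y ∧ b.rel x y := Iff.rfl

theorem top_rel {x y : ℕ} :
    (⊤ : NC n).rel x y ↔ x = y ∨ (1 ≤ x ∧ x ≤ n ∧ 1 ≤ y ∧ y ≤ n) := Iff.rfl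

theorem bot_rel {x y : ℕ} : (⊥ : NC n).rel x y ↔ x = y := Iff.rfl

instance : Finite (NC n) := by
  refine Finite.of_injective
    (fun a : NC n => fun (x y : Fin (n + 1)) => a.rel x y) fun a b h => ?_
  have key : ∀ x y, x ≤ n → y ≤ n → (a.rel x y ↔ b.rel x y) := fun x y hx hy =>
    iff_of_eq (congrFun (congrFun h ⟨x, by omega⟩) ⟨y, by omega⟩)
  ext x y
  rcases eq_or_ne x y with rfl | hne
  · exact ⟨fun _ => b.refl x, fun _ => a.refl x⟩
  · exact ⟨fun r => (key x y (a.bdd r hne).2 (a.bdd (a.symm r) hne.symm).2).1 r,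
      fun r => (key x y (b.bdd r hne).2 (b.bdd (b.symm r) hne.symm).2).2 r⟩

/-- The Kreweras complement: `x` and `y` are related when no pair of `a` separates them. -/
def compl (a : NC n) : NC n where
  rel x y := x = y ∨ ((1 ≤ x ∧ x ≤ n ∧ 1 ≤ y ∧ y ≤ n) ∧
    ∀ z w, z < w → a.rel z w → ((z < x ∧ x ≤ w) ↔ (z < y ∧ y ≤ w)))
  refl x := Or.inl rfl
  symm := by
    rintro x y (rfl | ⟨h, h'⟩)
    · exact Or.inl rfl
    · exact Or.inr ⟨by omega, fun z w hzw r => (h' z w hzw r).symm⟩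
  trans := by
    rintro x y z (rfl | ⟨h, h'⟩) (rfl | ⟨k, k'⟩)
    · exact Or.inl rfl
    · exact Or.inr ⟨k, k'⟩
    · exact Or.inr ⟨h, h'⟩
    · exact Or.inr ⟨by omega, fun z w hzw r => (h' z w hzw r).trans (k' z w hzw r)⟩
  bdd := by
    rintro x y (rfl | ⟨h, h'⟩) hne
    · exact absurd rfl hne
    · omega
  noncrossing := by
    rintro x y z w h₁ h₂ h₃ (rfl | ⟨h, h'⟩) (rfl | ⟨k, k'⟩)
    · omega
    · omega
    · omega
    · refine Or.inr ⟨by omega, fun p q hpq r => ?_⟩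
      have := h' p q hpq r
      have := k' p q hpq r
      omega

/-- The intervals are half-open because in the complement the label x stands for the gap just before
x; this keeps the complement on the same set. -/
theorem compl_rel {a : NC n} {x y : ℕ} : a.compl.rel x y ↔
    x = y ∨ ((1 ≤ x ∧ x ≤ n ∧ 1 ≤ y ∧ y ≤ n) ∧
      ∀ z w, z < w → a.rel z w → ((z < x ∧ x ≤ w) ↔ (z < y ∧ y ≤ w))) := Iff.rfl

theorem compl_anti {a b : NC n} (h : a ≤ b) : b.compl ≤ a.compl := by
  rintro x y (rfl | ⟨k, k'⟩)
  · exact Or.inl rfl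
  · exact Or.inr ⟨k, fun z w hzw r => k' z w hzw (h r)⟩

theorem compl_bot : (⊥ : NC n).compl = ⊤ := by
  refine le_antisymm le_top fun x y h => ?_
  rcases h with rfl | h
  · exact Or.inl rfl
  · refine Or.inr ⟨h, fun z w hzw r => ?_⟩
    have : z = w := r
    omega

theorem inf_compl_self (a : NC n) : a ⊓ a.compl = ⊥ := by
  refine le_antisymm ?_ bot_le
  rintro x y ⟨h, rfl | ⟨-, h'⟩⟩
  · exact rfl
  · rcases lt_trichotomy x y with hlt | rfl | hlt
    · have := h' x y hlt h
      omega
    · exact rfl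
    · have := h' y x hlt (a.symm h)
      omega

/-- Induction on the distance w - z; one may assume that z and w are not `a`-related and that no
`b`-relative of z lies strictly between them. -/
theorem saturated_aux {a b : NC n} (hab : a ≤ b) {S : ℕ → Prop}
    (ha : ∀ x y, a.rel x y → (S x ↔ S y))
    (hb : ∀ x y, (b ⊓ a.compl).rel x y → (S x ↔ S y)) (k : ℕ) :
    ∀ z w, z < w → w - z = k → b.rel z w → (S z ↔ S w) := by
  induction k using Nat.strong_induction_on with
  | _ k ih =>
  intro z w hzw hk hr
  by_cases hbt : ∃ v, z < v ∧ v < w ∧ b.rel z v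
  · obtain ⟨v, h₁, h₂, h₃⟩ := hbt
    exact (ih (v - z) (by omega) z v h₁ rfl h₃).trans
      (ih (w - v) (by omega) v w h₂ rfl (b.trans (b.symm h₃) hr))
  have hno : ∀ v, z < v → v < w → ¬ b.rel z v := fun v h₁ h₂ h₃ => hbt ⟨v, h₁, h₂, h₃⟩
  by_cases hazw : a.rel z w
  · exact ha z w hazw
  have bz := b.bdd hr hzw.ne
  have bw := b.bdd (b.symm hr) hzw.ne'
  classical
  -- Let u be the first `a`-relative of z met when going up cyclically from w. No pair of `a`
  -- separates the gaps before u and w, so z connects to u by `a` and u to w by the relative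
  -- complement.
  by_cases hu : ∃ u, w < u ∧ a.rel z u
  · have hmin : ∀ v, w ≤ v → v < Nat.find hu → ¬ a.rel z v := by
      intro v h₁ h₂ h₃
      rcases h₁.eq_or_lt with rfl | h₁
      · exact hazw h₃
      · exact Nat.find_min hu h₂ ⟨h₁, h₃⟩
    obtain ⟨hwu, hzu⟩ := Nat.find_spec hu
    generalize Nat.find hu = u at *
    have bu := a.bdd (a.symm hzu) (by omega)
    refine (ha z u hzu).trans (hb w u ⟨b.trans (b.symm hr) (hab hzu), Or.inr ⟨by omega, ?_⟩⟩).symm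
    intro p q hpq hr'
    constructor
    · rintro ⟨h₁, h₂⟩
      refine ⟨by omega, ?_⟩
      by_contra h₃
      rcases lt_trichotomy p z with h₄ | rfl | h₄
      · exact hmin q h₂ (by omega)
          (a.trans (a.symm (a.noncrossing h₄ (by omega) (by omega) hr' hzu)) hr')
      · exact hmin q h₂ (by omega) hr'
      · rcases h₂.eq_or_lt with rfl | h₂
        · exact hno p h₄ h₁ (b.trans hr (b.symm (hab hr')))
        · exact hno p h₄ h₁ (b.noncrossing h₄ h₁ h₂ hr (hab hr'))
    · rintro ⟨h₁, h₂⟩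
      refine ⟨?_, by omega⟩
      by_contra h₃
      rcases h₂.eq_or_lt with rfl | h₂
      · exact hmin p (by omega) h₁ (a.trans hzu (a.symm hr'))
      · exact hmin p (by omega) h₁ (a.noncrossing (by omega) h₁ h₂ hzu hr')
  · have hmax : ∀ v, w ≤ v → ¬ a.rel z v := by
      intro v h₁ h₃
      rcases h₁.eq_or_lt with rfl | h₁
      · exact hazw h₃
      · exact hu ⟨v, h₁, h₃⟩
    have hex : ∃ u, a.rel z u := ⟨z, a.refl z⟩
    have huz : Nat.find hex ≤ z := Nat.find_min' hex (a.refl z)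
    have hmin : ∀ v, v < Nat.find hex → ¬ a.rel z v := fun v => Nat.find_min hex
    have hzu := Nat.find_spec hex
    generalize Nat.find hex = u at *
    have bu : 1 ≤ u ∧ u ≤ n := by
      rcases eq_or_ne u z with rfl | hne
      · exact bz
      · exact a.bdd (a.symm hzu) hne
    refine (ha z u hzu).trans (hb u w ⟨b.trans (b.symm (hab hzu)) hr, Or.inr ⟨by omega, ?_⟩⟩)
    intro p q hpq hr'
    constructor
    · rintro ⟨h₁, h₂⟩
      refine ⟨by omega, ?_⟩
      by_contra h₃
      rcases h₂.eq_or_lt with rfl | h₂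
      · exact hmin p h₁ (a.trans hzu (a.symm hr'))
      rcases lt_trichotomy q z with h₄ | rfl | h₄
      · exact hmin p h₁ (a.trans hzu (a.symm
          (a.noncrossing h₁ h₂ h₄ hr' (a.symm hzu))))
      · exact hmin p h₁ (a.symm hr')
      · exact hno q h₄ (by omega) (b.trans (b.symm
          (b.noncrossing (by omega) h₄ (by omega) (hab hr') hr)) (hab hr'))
    · rintro ⟨h₁, h₂⟩
      refine ⟨?_, by omega⟩
      by_contra h₃
      rcases lt_trichotomy z p with h₄ | rfl | h₄
      · rcases h₂.eq_or_lt with rfl | h₂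
        · exact hno p h₄ h₁ (b.trans hr (b.symm (hab hr')))
        · exact hno p h₄ h₁ (b.noncrossing h₄ h₁ h₂ hr (hab hr'))
      · exact hmax q h₂ hr'
      · rcases (not_lt.1 h₃).eq_or_lt with rfl | h₃
        · exact hmax q h₂ (a.trans hzu hr')
        · exact hmax q h₂ (a.trans hzu (a.trans
            (a.noncrossing h₃ h₄ (by omega) (a.symm hzu) hr') hr'))

/-- For `a ≤ b`, the relation `b` is generated by `a` and the relative complement `b ⊓ a.compl`. -/
theorem saturated {a b : NC n} (hab : a ≤ b) {S : ℕ → Prop}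
    (ha : ∀ x y, a.rel x y → (S x ↔ S y))
    (hb : ∀ x y, (b ⊓ a.compl).rel x y → (S x ↔ S y)) {x y : ℕ} (h : b.rel x y) :
    S x ↔ S y := by
  rcases lt_trichotomy x y with hlt | rfl | hlt
  · exact saturated_aux hab ha hb _ x y hlt rfl h
  · exact Iff.rfl
  · exact (saturated_aux hab ha hb _ y x hlt rfl (b.symm h)).symm

theorem le_of_le_of_inf_compl_le {a b d : NC n} (hab : a ≤ b) (had : a ≤ d)
    (h : b ⊓ a.compl ≤ d) : b ≤ d := fun x _ hxy =>
  (saturated hab (S := d.rel x) (fun _ _ r => ⟨fun r' => d.trans r' (had r),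
    fun r' => d.trans r' (d.symm (had r))⟩) (fun _ _ r => ⟨fun r' => d.trans r' (h r),
    fun r' => d.trans r' (d.symm (h r))⟩) hxy).1 (d.refl x)

/-- This is (a⁻¹b)⁻¹(a⁻¹δ) = b⁻¹δ. Two gaps are unseparated by `b` as soon as they are unseparated
by a generating set of `b`. -/
theorem compl_inf_compl_inf {a b : NC n} (hab : a ≤ b) :
    a.compl ⊓ (b ⊓ a.compl).compl = b.compl := by
  refine le_antisymm ?_ (le_inf (compl_anti hab) (compl_anti inf_le_left))
  rintro x y ⟨h | ⟨h, h₁⟩, h' | ⟨-, h₂⟩⟩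
  · exact Or.inl h
  · exact Or.inl h
  · exact Or.inl h'
  · refine Or.inr ⟨h, fun z w hzw r => ?_⟩
    -- S fails exactly at the points between the gaps x and y, so a pair separates these gaps iff
    -- exactly one of its ends satisfies S.
    have hS := saturated hab (S := fun v => (v < x ↔ v < y))
      (fun p q r => ?_) (fun p q r => ?_) r
    · have : z < x ∧ w < x ∨ ¬ (z < x ∧ w < x) := em _
      omega
    · rcases lt_trichotomy p q with h | rfl | h
      · have := h₁ p q h r
        omega
      · rfl
      · have := h₁ q p h (a.symm r)
        omega
    · rcases lt_trichotomy p q with h | rfl | h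
      · have := h₂ p q h r
        omega
      · rfl
      · have := h₂ q p h (symm _ r)
        omega

/-- If `b` relates x < y but `a` does not, some block of K(a) is cut by the pair (x, y), so it
cannot lie in a block of K(b). -/
theorem le_of_compl_le {a b : NC n} (h : a.compl ≤ b.compl) : b ≤ a := by
  have key : ∀ x y, x < y → b.rel x y → a.rel x y := by
    intro x y hxy hr
    by_contra hna
    have bx := b.bdd hr hxy.ne
    have hby := b.bdd (b.symm hr) hxy.ne'
    suffices hs : ∃ u v, (x < u ∧ u ≤ y) ∧ ¬ (x < v ∧ v ≤ y) ∧ a.compl.rel u v by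
      obtain ⟨u, v, hu, hv, r⟩ := hs
      rcases h r with rfl | ⟨-, h'⟩
      · exact hv hu
      · exact hv ((h' x y hxy hr).1 hu)
    classical
    have hxp : x ≤ Nat.findGreatest (a.rel x) (y - 1) :=
      Nat.le_findGreatest (by omega) (a.refl x)
    have hpy : Nat.findGreatest (a.rel x) (y - 1) ≤ y - 1 := Nat.findGreatest_le _
    have hp : a.rel x (Nat.findGreatest (a.rel x) (y - 1)) :=
      Nat.findGreatest_spec (P := a.rel x) (m := x) (by omega) (a.refl x)
    have hpmax : ∀ v, Nat.findGreatest (a.rel x) (y - 1) < v → v ≤ y → ¬ a.rel x v := by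
      intro v h₁ h₂ h₃
      rcases h₂.eq_or_lt with rfl | h₂
      · exact hna h₃
      · exact Nat.findGreatest_is_greatest h₁ (by omega) h₃
    generalize Nat.findGreatest (a.rel x) (y - 1) = p at *
    by_cases hq : ∃ q, y < q ∧ a.rel x q
    · have hqmin : ∀ v, p < v → v < Nat.find hq → ¬ a.rel x v := by
        intro v h₁ h₂ h₃
        rcases le_or_gt v y with h₄ | h₄
        · exact hpmax v h₁ h₄ h₃
        · exact Nat.find_min hq h₂ ⟨h₄, h₃⟩
      obtain ⟨hyq, hxq⟩ := Nat.find_spec hq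
      generalize Nat.find hq = q at *
      have bq := a.bdd (a.symm hxq) (by omega)
      -- p and q are consecutive in the `a`-block of x, so K(a) relates the gap after p, labelled p
      -- + 1, to the gap before q. In the other case below, the successor of p wraps around to the
      -- least element m.
      refine ⟨p + 1, q, by omega, by omega, Or.inr ⟨by omega, fun c d hcd r => ?_⟩⟩
      constructor
      · rintro ⟨h₁, h₂⟩
        refine ⟨by omega, ?_⟩
        by_contra h₃
        rcases (Nat.lt_succ_iff.1 h₁).eq_or_lt with rfl | h₁
        · exact hqmin d h₂ (by omega) (a.trans hp r)
        · exact hqmin d h₂ (by omega) (a.trans hp (a.trans (a.symm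
            (a.noncrossing h₁ h₂ (by omega) r (a.trans (a.symm hp) hxq))) r))
      · rintro ⟨h₁, h₂⟩
        refine ⟨?_, by omega⟩
        by_contra h₃
        rcases h₂.eq_or_lt with rfl | h₂
        · exact hqmin c (by omega) h₁ (a.trans hxq (a.symm r))
        · exact hqmin c (by omega) h₁ (a.trans hp
            (a.noncrossing (by omega) h₁ h₂ (a.trans (a.symm hp) hxq) r))
    · have hmax : ∀ v, p < v → ¬ a.rel x v := by
        intro v h₁ h₂
        rcases le_or_gt v y with h₄ | h₄
        · exact hpmax v h₁ h₄ h₂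
        · exact hq ⟨v, h₄, h₂⟩
      have hex : ∃ u, a.rel x u := ⟨x, a.refl x⟩
      have hmx : Nat.find hex ≤ x := Nat.find_min' hex (a.refl x)
      have hmin : ∀ v, v < Nat.find hex → ¬ a.rel x v := fun v => Nat.find_min hex
      have hm := Nat.find_spec hex
      generalize Nat.find hex = m at *
      have bm : 1 ≤ m ∧ m ≤ n := by
        rcases eq_or_ne m x with rfl | hne
        · exact bx
        · exact a.bdd (a.symm hm) hne
      refine ⟨p + 1, m, by omega, by omega, Or.inr ⟨by omega, fun c d hcd r => ?_⟩⟩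
      constructor
      · rintro ⟨h₁, h₂⟩
        refine ⟨?_, by omega⟩
        by_contra h₃
        rcases (Nat.lt_succ_iff.1 h₁).eq_or_lt with rfl | h₁
        · exact hmax d h₂ (a.trans hp r)
        rcases (not_lt.1 h₃).eq_or_lt with rfl | h₃
        · exact hmax d h₂ (a.trans hm r)
        · exact hmax d h₂ (a.trans hm (a.trans
            (a.noncrossing h₃ h₁ h₂ (a.trans (a.symm hm) hp) r) r))
      · rintro ⟨h₁, h₂⟩
        refine ⟨by omega, ?_⟩
        by_contra h₃
        rcases h₂.eq_or_lt with rfl | h₂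
        · exact hmin c h₁ (a.trans hm (a.symm r))
        rcases (show d ≤ p by omega).eq_or_lt with rfl | h₄
        · exact hmin c h₁ (a.trans hp (a.symm r))
        · exact hmin c h₁ (a.trans hm (a.symm
            (a.noncrossing h₁ h₂ h₄ r (a.trans (a.symm hm) hp))))
  intro x y hr
  rcases lt_trichotomy x y with hlt | rfl | hlt
  · exact key x y hlt hr
  · exact a.refl x
  · exact a.symm (key y x hlt (b.symm hr))

theorem compl_bijective : Function.Bijective (compl : NC n → NC n) :=
  Finite.injective_iff_bijective.1 fun _ _ h =>
    le_antisymm (le_of_compl_le h.ge) (le_of_compl_le h.le)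

/-- The Kreweras complement as a permutation. -/
noncomputable def complEquiv : Equiv.Perm (NC n) := Equiv.ofBijective compl compl_bijective

/-- The join of noncrossing partitions. If `v ≤ u.compl` it plays the role of the product `u v`. -/
noncomputable def prod (u v : NC n) : NC n := complEquiv.symm (u.compl ⊓ v.compl)

theorem compl_prod (u v : NC n) : (prod u v).compl = u.compl ⊓ v.compl :=
  complEquiv.apply_symm_apply _

theorem compl_injective : Function.Injective (compl : NC n → NC n) := compl_bijective.1

theorem le_prod_left (u v : NC n) : u ≤ prod u v :=
  le_of_compl_le (by rw [compl_prod]; exact inf_le_left)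

theorem le_prod_right (u v : NC n) : v ≤ prod u v :=
  le_of_compl_le (by rw [compl_prod]; exact inf_le_right)

theorem prod_le {u v w : NC n} (hu : u ≤ w) (hv : v ≤ w) : prod u v ≤ w :=
  le_of_compl_le (by rw [compl_prod]; exact le_inf (compl_anti hu) (compl_anti hv))

theorem prod_inf_compl {a b : NC n} (h : a ≤ b) : prod a (b ⊓ a.compl) = b :=
  compl_injective (by rw [compl_prod, compl_inf_compl_inf h])

/-- Relative complements: `(a⁻¹b)⁻¹(a⁻¹d) = b⁻¹d`. -/
theorem inf_compl_inf_compl {a b d : NC n} (hab : a ≤ b) :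
    (d ⊓ a.compl) ⊓ (b ⊓ a.compl).compl = d ⊓ b.compl := by
  rw [inf_assoc, compl_inf_compl_inf hab]

theorem le_of_inf_compl_le {v v' x : NC n} (hv : v ≤ x) (hv' : v' ≤ x)
    (h : x ⊓ v.compl ≤ v'.compl) : v' ≤ v := by
  refine le_of_compl_le (le_of_le_of_inf_compl_le (a := x ⊓ v.compl) inf_le_right h ?_)
  rw [compl_inf_compl_inf hv]
  exact compl_anti hv'

/-- Cancellation u⁻¹(uv) = v: both sides have the same relative complement in K(a), and relative
complements reflect the order. -/
theorem prod_inf {a v : NC n} (h : v ≤ a.compl) : prod a v ⊓ a.compl = v := by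
  have h₁ : a.compl ⊓ (prod a v ⊓ a.compl).compl = a.compl ⊓ v.compl := by
    rw [compl_inf_compl_inf (le_prod_left a v), compl_prod]
  exact le_antisymm (le_of_inf_compl_le h inf_le_right (h₁.ge.trans inf_le_right))
    (le_of_inf_compl_le inf_le_right h (h₁.le.trans inf_le_right))

theorem eq_of_inf_compl_eq_bot {a b : NC n} (hab : a ≤ b) (h : b ⊓ a.compl = ⊥) : a = b :=
  le_antisymm hab (le_of_le_of_inf_compl_le hab le_rfl (h.le.trans bot_le))

/-- The noncrossing partition whose only nontrivial block is `{s, t}`. -/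
def atom (s t : ℕ) (hs : 1 ≤ s) (hst : s < t) (ht : t ≤ n) : NC n where
  rel x y := x = y ∨ ((x = s ∨ x = t) ∧ (y = s ∨ y = t))
  refl x := Or.inl rfl
  symm := by omega
  trans := by omega
  bdd := by omega
  noncrossing := by omega

theorem atom_rel {s t : ℕ} {hs : 1 ≤ s} {hst : s < t} {ht : t ≤ n} {x y : ℕ} :
    (atom s t hs hst ht).rel x y ↔ x = y ∨ ((x = s ∨ x = t) ∧ (y = s ∨ y = t)) := Iff.rfl

theorem atom_le_iff {s t : ℕ} {hs : 1 ≤ s} {hst : s < t} {ht : t ≤ n} {a : NC n} :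
    atom s t hs hst ht ≤ a ↔ a.rel s t := by
  constructor
  · intro h
    exact h (Or.inr ⟨Or.inl rfl, Or.inr rfl⟩)
  · rintro h x y (rfl | ⟨rfl | rfl, rfl | rfl⟩)
    exacts [a.refl _, a.refl _, h, a.symm h, a.refl _]

theorem compl_atom_rel {s t : ℕ} {hs : 1 ≤ s} {hst : s < t} {ht : t ≤ n} {x y : ℕ} :
    (atom s t hs hst ht).compl.rel x y ↔ x = y ∨ ((1 ≤ x ∧ x ≤ n ∧ 1 ≤ y ∧ y ≤ n) ∧
      ((s < x ∧ x ≤ t) ↔ (s < y ∧ y ≤ t))) := by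
  rw [compl_rel]
  refine or_congr_right (and_congr_right fun _ => ⟨fun h => h s t hst ?_, fun h z w hzw r => ?_⟩)
  · exact Or.inr ⟨Or.inl rfl, Or.inr rfl⟩
  · rw [atom_rel] at r
    obtain ⟨rfl, rfl⟩ : z = s ∧ w = t := by omega
    exact h

theorem inf_compl_atom_rel {b : NC n} {s t : ℕ} {hs : 1 ≤ s} {hst : s < t} {ht : t ≤ n}
    {x y : ℕ} : (b ⊓ (atom s t hs hst ht).compl).rel x y ↔
      b.rel x y ∧ ((s < x ∧ x ≤ t) ↔ (s < y ∧ y ≤ t)) := by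
  rw [inf_rel, compl_atom_rel]
  refine and_congr_right fun h => ?_
  have := top_rel.1 (le_top (a := b) h)
  constructor
  · rintro (rfl | h)
    exacts [Iff.rfl, h.2]
  · intro h'
    rcases this with rfl | h
    exacts [Or.inl rfl, Or.inr ⟨h, h'⟩]

theorem exists_rel_of_ne_bot {a : NC n} (h : a ≠ ⊥) :
    ∃ s t, 1 ≤ s ∧ s < t ∧ t ≤ n ∧ a.rel s t := by
  by_contra hno
  refine h (le_antisymm (fun x y r => ?_) bot_le)
  rw [bot_rel]
  by_contra hne
  have h₁ := a.bdd r hne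
  have h₂ := a.bdd (a.symm r) (Ne.symm hne)
  rcases lt_or_gt_of_ne hne with hlt | hlt
  · exact hno ⟨x, y, h₁.1, hlt, h₂.2, r⟩
  · exact hno ⟨y, x, h₂.1, hlt, h₁.2, a.symm r⟩

theorem inf_compl_lt {a b : NC n} (hab : a ≤ b) (ha : a ≠ ⊥) : b ⊓ a.compl < b := by
  refine lt_of_le_of_ne inf_le_left fun h => ha ?_
  rw [← inf_compl_self a]
  exact (inf_eq_left.2 (hab.trans (h.ge.trans inf_le_right))).symm

theorem atom_ne_bot {s t : ℕ} {hs : 1 ≤ s} {hst : s < t} {ht : t ≤ n} :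
    atom s t hs hst ht ≠ ⊥ := fun h => hst.ne
  (bot_rel.1 (h.le (show (atom s t hs hst ht).rel s t from Or.inr ⟨Or.inl rfl, Or.inr rfl⟩)))

end NC
end Braid

namespace Braid

/-! ### Formally inverting an injective self-map. -/

section Telescope

variable {X : Type*}

/-- Pairs `(k, x)`, thought of as `D⁻ᵏ x`, up to the evident identification. -/
def telescopeSetoid (D : X → X) (hD : Function.Injective D) : Setoid (ℕ × X) where
  r p q := D^[q.1] p.2 = D^[p.1] q.2
  iseqv :=
    { refl _ := rfl
      symm := Eq.symm
      trans := by
        rintro ⟨k, x⟩ ⟨l, y⟩ ⟨m, z⟩ h h'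
        -- Transitivity needs the middle power D^l to be cancelled; this is where injectivity
        -- enters.
        refine hD.iterate l ?_
        dsimp only at h h' ⊢
        rw [← Function.iterate_add_apply, add_comm, Function.iterate_add_apply, h,
          ← Function.iterate_add_apply, add_comm, Function.iterate_add_apply, h',
          ← Function.iterate_add_apply, add_comm, Function.iterate_add_apply] }

/-- The telescope of an injective self-map `D`, on which `D` becomes bijective. -/
def Telescope (D : X → X) (hD : Function.Injective D) : Type _ :=
  Quotient (telescopeSetoid D hD)

namespace Telescope

variable {D : X → X} {hD : Function.Injective D}

/-- The inclusion of the underlying set. -/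
def ofBase (x : X) : Telescope D hD := Quotient.mk _ (0, x)

theorem ofBase_injective : Function.Injective (ofBase : X → Telescope D hD) := fun _ _ h =>
  Quotient.exact h

/-- The extension of a self-map that commutes with `D`. -/
def map (f : X → X) (hf : Function.Commute f D) : Telescope D hD → Telescope D hD :=
  Quotient.map (fun p => (p.1, f p.2)) fun p q (h : D^[q.1] p.2 = D^[p.1] q.2) =>
    show D^[q.1] (f p.2) = D^[p.1] (f q.2) by
      rw [← (hf.iterate_right _).eq, h, (hf.iterate_right _).eq]

theorem map_map (f g h : X → X) (hf : Function.Commute f D) (hg : Function.Commute g D)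
    (hh : Function.Commute h D) (e : ∀ x, f (g x) = h x) (q : Telescope D hD) :
    map f hf (map g hg q) = map h hh q := by
  induction q using Quotient.inductionOn with
  | _ p => exact congrArg (fun y => (Quotient.mk _ (p.1, y) : Telescope D hD)) (e p.2)

theorem map_self_bijective :
    Function.Bijective (map D (Function.Commute.refl D) : Telescope D hD → Telescope D hD) := by
  constructor
  · intro q q' h
    induction q using Quotient.inductionOn with
    | _ p =>
    induction q' using Quotient.inductionOn with
    | _ p' =>
    have h₁ : D^[p'.1] (D p.2) = D^[p.1] (D p'.2) := Quotient.exact h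
    rw [← Function.iterate_succ_apply, ← Function.iterate_succ_apply,
      Function.iterate_succ_apply', Function.iterate_succ_apply'] at h₁
    exact Quotient.sound (hD h₁)
  · intro q
    induction q using Quotient.inductionOn with
    | _ p =>
    refine ⟨Quotient.mk _ (p.1 + 1, p.2), Quotient.sound ?_⟩
    change D^[p.1] (D p.2) = D^[p.1 + 1] p.2
    rw [Function.iterate_succ_apply]

end Telescope

end Telescope

/-! ### Left-weighted sequences and the action of noncrossing partitions. -/

namespace NC

variable {n : ℕ}

open Classical in
/-- Left multiplication of a sequence of noncrossing partitions: in each step the head absorbs as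
much as possible of the next entry. -/
noncomputable def act : NC n → List (NC n) → List (NC n)
  | s, [] => if s = ⊥ then [] else [s]
  | s, h :: t => prod s (h ⊓ s.compl) :: act (h ⊓ (h ⊓ s.compl).compl) t

theorem act_bot_nil : act (⊥ : NC n) [] = [] := if_pos rfl

theorem act_nil {s : NC n} (h : s ≠ ⊥) : act s [] = [s] := if_neg h

theorem act_cons (s h : NC n) (t : List (NC n)) :
    act s (h :: t) = prod s (h ⊓ s.compl) :: act (h ⊓ (h ⊓ s.compl).compl) t := rfl

theorem prod_bot_left (v : NC n) : prod ⊥ v = v :=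
  compl_injective (by rw [compl_prod, compl_bot, top_inf_eq])

theorem prod_bot_right (v : NC n) : prod v ⊥ = v :=
  compl_injective (by rw [compl_prod, compl_bot, inf_top_eq])

theorem compl_top : (⊤ : NC n).compl = ⊥ := by
  simpa using inf_compl_self (⊤ : NC n)

theorem act_bot (x : List (NC n)) : act ⊥ x = x := by
  induction x with
  | nil => exact act_bot_nil
  | cons h t ih => rw [act_cons, compl_bot, inf_top_eq, prod_bot_left, inf_compl_self, ih]

/-- Put v = u⁻¹w. First v absorbs h ⊓ K(v) from the head h, then u keeps only h ⊓ K(v) ⊓ K(u) = h ⊓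
K(w) of it. The part given back joins what was passed to the tail, where the induction hypothesis
merges the two. -/
theorem act_act (x : List (NC n)) :
    ∀ {u w : NC n}, u ≤ w → act u (act (w ⊓ u.compl) x) = act w x := by
  induction x with
  | nil =>
    intro u w huw
    by_cases hv : w ⊓ u.compl = ⊥
    · rw [hv, act_bot_nil, eq_of_inf_compl_eq_bot huw hv]
    · have hw : w ≠ ⊥ := by
        rintro rfl
        exact hv (le_antisymm inf_le_left bot_le)
      rw [act_nil hv, act_nil hw, act_cons, inf_assoc, inf_idem, prod_inf_compl huw,
        inf_compl_self, act_bot_nil]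
  | cons h t ih =>
    intro u w huw
    set v := w ⊓ u.compl
    have hKw : w.compl = u.compl ⊓ v.compl := (compl_inf_compl_inf huw).symm
    have he : h ⊓ w.compl = h ⊓ v.compl ⊓ u.compl := by
      rw [hKw, inf_comm u.compl, inf_assoc]
    have hve : prod v (h ⊓ v.compl) ⊓ v.compl = h ⊓ v.compl := prod_inf inf_le_right
    have he₂ : prod v (h ⊓ v.compl) ⊓ u.compl = prod v (h ⊓ w.compl) := by
      rw [he, ← hve, inf_right_comm]
      exact (prod_inf_compl (le_inf (le_prod_left _ _) inf_le_right)).symm.trans (by rw [hve])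
    have hhead : prod u (prod v (h ⊓ w.compl)) = prod w (h ⊓ w.compl) := by
      refine compl_injective ?_
      rw [compl_prod, compl_prod, compl_prod, hKw, inf_assoc]
    have htail : prod v (h ⊓ v.compl) ⊓ (prod v (h ⊓ w.compl)).compl
        = (h ⊓ v.compl) ⊓ (h ⊓ w.compl).compl := by
      rw [compl_prod, ← inf_assoc, hve]
    have hle : h ⊓ w.compl ≤ h ⊓ v.compl := he.le.trans inf_le_left
    have ih' := ih (inf_le_inf_right (h ⊓ w.compl).compl (inf_le_left : h ⊓ v.compl ≤ h))
    rw [inf_compl_inf_compl hle] at ih'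
    rw [act_cons v, act_cons, he₂, hhead, htail, act_cons w, ih']

theorem act_prod {u v : NC n} (h : v ≤ u.compl) (x : List (NC n)) :
    act u (act v x) = act (prod u v) x := by
  conv_lhs => rw [← prod_inf h]
  exact act_act x (le_prod_left u v)

/-- Left-weighted sequences. -/
def IsNormal : List (NC n) → Prop
  | [] => True
  | h :: t => act h t = h :: t ∧ IsNormal t

theorem IsNormal.act {x : List (NC n)} (hx : IsNormal x) (s : NC n) : IsNormal (act s x) := by
  induction x generalizing s with
  | nil =>
    by_cases hs : s = ⊥
    · rw [hs, act_bot_nil]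
      trivial
    · rw [act_nil hs]
      exact ⟨act_nil hs, trivial⟩
  | cons h t ih =>
    rw [act_cons]
    refine ⟨?_, ih hx.2 _⟩
    rw [← act_cons, ← act_prod inf_le_right, act_act t inf_le_left, hx.1]

theorem act_top {x : List (NC n)} (hx : IsNormal x) (hn : (⊤ : NC n) ≠ ⊥) :
    act ⊤ x = ⊤ :: x := by
  cases x with
  | nil => exact act_nil hn
  | cons h t =>
    rw [act_cons, compl_top, inf_bot_eq, compl_bot, inf_top_eq, prod_bot_right, hx.1]

/-- The type of left-weighted sequences. -/
def Normal (n : ℕ) : Type := {x : List (NC n) // IsNormal x}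

namespace Normal

/-- Left multiplication of a left-weighted sequence. -/
noncomputable def act (s : NC n) (x : Normal n) : Normal n := ⟨NC.act s x.1, x.2.act s⟩

theorem act_act {u w : NC n} (h : u ≤ w) (x : Normal n) :
    act u (act (w ⊓ u.compl) x) = act w x := Subtype.ext (NC.act_act x.1 h)

theorem act_top_injective : Function.Injective (act (⊤ : NC n)) := by
  intro x y h
  have h' : NC.act ⊤ x.1 = NC.act ⊤ y.1 := congrArg Subtype.val h
  -- For n ≤ 1 the top element is trivial; otherwise it is simply prepended to a left-weighted
  -- sequence.
  by_cases hn : (⊤ : NC n) = ⊥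
  · rw [hn, act_bot, act_bot] at h'
    exact Subtype.ext h'
  · rw [act_top x.2 hn, act_top y.2 hn] at h'
    exact Subtype.ext (List.cons.inj h').2

theorem act_comp_act_compl (u : NC n) (x : Normal n) : act u (act u.compl x) = act ⊤ x := by
  conv_lhs => rw [← top_inf_eq u.compl]
  exact act_act le_top x

/-- From uK(u) = δ = K(u)K²(u) follows uδ = δK²(u). -/
theorem act_act_top (u : NC n) (x : Normal n) :
    act u (act ⊤ x) = act ⊤ (act u.compl.compl x) := by
  rw [← act_comp_act_compl u.compl, act_comp_act_compl u]

theorem act_iterate_act_top (k : ℕ) (u : NC n) (x : Normal n) :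
    act u ((act ⊤)^[k] x) = (act ⊤)^[k] (act ((compl ∘ compl)^[k] u) x) := by
  induction k generalizing u with
  | zero => rfl
  | succ k ih =>
    rw [Function.iterate_succ_apply', act_act_top, ih, Function.iterate_succ_apply',
      Function.iterate_succ_apply]
    rfl

/-- A central power of the action of the top element. -/
noncomputable def central (n : ℕ) : Normal n → Normal n :=
  (act ⊤)^[orderOf (complEquiv : Equiv.Perm (NC n))]

theorem central_injective : Function.Injective (central n) := act_top_injective.iterate _

/-- Passing k copies of δ changes u to K²ᵏ(u), which is u when k is the order of K. -/
theorem commute_central (u : NC n) : Function.Commute (act u) (central n) := by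
  intro x
  have h : ∀ k, (compl ∘ compl)^[k] u = ((complEquiv : Equiv.Perm (NC n)) ^ k)
      (((complEquiv : Equiv.Perm (NC n)) ^ k) u) := by
    intro k
    have e : (compl : NC n → NC n) = complEquiv := rfl
    rw [Function.Commute.comp_iterate (Function.Commute.refl _), e, Equiv.Perm.iterate_eq_pow]
    rfl
  have h' := act_iterate_act_top (orderOf (complEquiv : Equiv.Perm (NC n))) u x
  rw [h, pow_orderOf_eq_one] at h'
  exact h'

end Normal

/-- The set of left-weighted sequences with the central element inverted. -/
abbrev Frac (n : ℕ) : Type := Telescope (Normal.central n) Normal.central_injective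

/-- The action of noncrossing partitions on `Frac n`. -/
noncomputable def fracMap (u : NC n) : Frac n → Frac n :=
  Telescope.map (Normal.act u) (Normal.commute_central u)

theorem fracMap_fracMap {u w : NC n} (h : u ≤ w) (q : Frac n) :
    fracMap u (fracMap (w ⊓ u.compl) q) = fracMap w q :=
  Telescope.map_map _ _ _ _ _ _ (Normal.act_act h) q

theorem fracMap_top_iterate (k : ℕ) (hk : Function.Commute (Normal.act (⊤ : NC n))^[k]
    (Normal.central n)) (q : Frac n) :
    (fracMap ⊤)^[k] q = Telescope.map (Normal.act ⊤)^[k] hk q := by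
  induction k with
  | zero =>
    induction q using Quotient.inductionOn with
    | _ p => rfl
  | succ k ih =>
    rw [Function.iterate_succ_apply', ih ((Normal.commute_central ⊤).iterate_left k)]
    exact Telescope.map_map _ _ _ _ _ _
      (fun x => (Function.iterate_succ_apply' (Normal.act ⊤) k x).symm) q

/-- A power of this map is the extension of the central map, which the telescope made bijective. -/
theorem fracMap_top_bijective : Function.Bijective (fracMap (⊤ : NC n)) := by
  have h : Function.Bijective (fracMap (⊤ : NC n))^[orderOf (complEquiv : Equiv.Perm (NC n))] := by
    rw [show (fracMap (⊤ : NC n))^[orderOf (complEquiv : Equiv.Perm (NC n))]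
      = Telescope.map (Normal.central n) (Function.Commute.refl _) from
        funext (fracMap_top_iterate _ _)]
    exact Telescope.map_self_bijective
  obtain ⟨k, hk⟩ := Nat.exists_eq_succ_of_ne_zero
    (orderOf_pos (complEquiv : Equiv.Perm (NC n))).ne'
  rw [hk] at h
  refine ⟨Function.Injective.of_comp (f := (fracMap ⊤)^[k]) ?_,
    Function.Surjective.of_comp (g := (fracMap ⊤)^[k]) ?_⟩
  · rw [← Function.iterate_succ]
    exact h.1
  · rw [← Function.iterate_succ']
    exact h.2

/-- δ = uK(u) makes u surjective and K(u) injective, and every partition is some K(v). -/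
theorem fracMap_bijective (u : NC n) : Function.Bijective (fracMap u) := by
  have h : ∀ v : NC n, fracMap v ∘ fracMap v.compl = fracMap ⊤ := fun v => funext fun q => by
    conv_rhs => rw [← fracMap_fracMap (le_top : v ≤ ⊤)]
    rw [top_inf_eq]
    rfl
  constructor
  · obtain ⟨v, rfl⟩ := compl_bijective.2 u
    exact Function.Injective.of_comp (f := fracMap v) (by rw [h]; exact fracMap_top_bijective.1)
  · exact Function.Surjective.of_comp (g := fracMap u.compl)
      (by rw [h]; exact fracMap_top_bijective.2)

/-- The permutation of `Frac n` given by a noncrossing partition. -/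
noncomputable def fracPerm (u : NC n) : Equiv.Perm (Frac n) :=
  Equiv.ofBijective _ (fracMap_bijective u)

theorem fracPerm_mul {u w : NC n} (h : u ≤ w) :
    fracPerm u * fracPerm (w ⊓ u.compl) = fracPerm w := Equiv.ext (fracMap_fracMap h)

theorem fracPerm_mul_prod {u v : NC n} (h : v ≤ u.compl) :
    fracPerm u * fracPerm v = fracPerm (prod u v) := by
  rw [← fracPerm_mul (le_prod_left u v), prod_inf h]

theorem fracPerm_ofBase (u : NC n) (x : Normal n) :
    fracPerm u (Telescope.ofBase x) = Telescope.ofBase (Normal.act u x) := rfl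

end NC
end Braid

namespace Braid

variable {n : ℕ}

/-! ### Relations between band generators. -/

theorem sigma_commute_of_lt {i j : ℕ} (h : i + 1 < j) : Commute (sigma n i) (sigma n j) := by
  unfold sigma
  split_ifs with hi hj
  · refine mul_inv_eq_one.1 (PresentedGroup.one_of_mem (rels := artinRels n)
      ⟨⟨i, hi⟩, ⟨j, hj⟩, Or.inl ⟨?_, rfl⟩⟩)
    rw [abs_sub_comm, abs_of_pos] <;> dsimp only <;> omega
  · exact Commute.one_right _
  · exact Commute.one_left _
  · exact Commute.one_left _

theorem sigma_braid {i : ℕ} (h₁ : 1 ≤ i) (h₂ : i + 1 < n) :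
    sigma n i * sigma n (i + 1) * sigma n i = sigma n (i + 1) * sigma n i * sigma n (i + 1) := by
  have hi : 1 ≤ i ∧ i < n := by omega
  have hj : 1 ≤ i + 1 ∧ i + 1 < n := by omega
  unfold sigma
  rw [dif_pos hi, dif_pos hj]
  refine mul_inv_eq_one.1 (PresentedGroup.one_of_mem (rels := artinRels n)
      ⟨⟨i, hi⟩, ⟨i + 1, hj⟩, Or.inr ⟨?_, rfl⟩⟩)
  simp

theorem band_succ_self (s : ℕ) : band n (s + 1) s = sigma n s := by
  simp [band]

theorem band_succ {s t : ℕ} (h : s < t) :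
    band n (t + 1) s = sigma n t * band n t s * (sigma n t)⁻¹ := by
  simp [band, List.Ico.succ_top (show s + 1 ≤ t by omega), mul_assoc]

theorem sigma_mul_band {s t : ℕ} (h : s < t) :
    sigma n t * band n t s = band n (t + 1) s * sigma n t := by
  rw [band_succ h, inv_mul_cancel_right]

theorem sigma_commute_band_of_lt {s t i : ℕ} (hst : s < t) (h : t < i) :
    Commute (sigma n i) (band n t s) := by
  induction t, hst using Nat.le_induction with
  | base => exact band_succ_self (n := n) s ▸ (sigma_commute_of_lt h).symm
  | succ t hst ih =>
    rw [band_succ hst]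
    have hc := (sigma_commute_of_lt (n := n) (show t + 1 < i by omega)).symm
    exact (hc.mul_right (ih (by omega))).mul_right hc.inv_right

/-- In the base case conjugation by σ_{i+1}σ_i turns the commuting pair σ_{i+1}, a_{is} into σ_i,
a_{(i+2)s}. -/
theorem sigma_commute_band_of_mem {s t i : ℕ} (hs : 1 ≤ s) (hsi : s < i) (hit : i + 1 < t)
    (htn : t ≤ n) : Commute (sigma n i) (band n t s) := by
  induction t, (show i + 2 ≤ t from hit) using Nat.le_induction with
  | base =>
    have h₁ : sigma n i = sigma n (i + 1) * sigma n i * sigma n (i + 1)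
        * (sigma n (i + 1) * sigma n i)⁻¹ := by
      rw [← sigma_braid (by omega) (by omega)]
      group
    have h₂ : band n (i + 2) s
        = sigma n (i + 1) * sigma n i * band n i s * (sigma n (i + 1) * sigma n i)⁻¹ := by
      rw [band_succ (show s < i + 1 by omega), band_succ hsi]
      group
    rw [h₂]
    nth_rewrite 1 [h₁]
    exact SemiconjBy.conj_iff.2 (sigma_commute_band_of_lt hsi (by omega))
  | succ t hst ih =>
    rw [band_succ (by omega)]
    have hc := sigma_commute_of_lt (n := n) (show i + 1 < t by omega)
    exact (hc.mul_right (ih (by omega) (by omega))).mul_right hc.inv_right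

theorem commute_band_of_sigma {g : BraidGroup n} {s t : ℕ} (hst : s < t)
    (h : ∀ i, s ≤ i → i < t → Commute g (sigma n i)) : Commute g (band n t s) := by
  induction t, hst using Nat.le_induction with
  | base => exact band_succ_self (n := n) s ▸ h s le_rfl (by omega)
  | succ t hst ih =>
    rw [band_succ hst]
    have hc := h t (by omega) (by omega)
    exact (hc.mul_right (ih fun i h₁ h₂ => h i h₁ (by omega))).mul_right hc.inv_right

theorem band_commute_of_disjoint {q r s t : ℕ} (h₁ : q < r) (h₂ : r < s) (h₃ : s < t) :
    Commute (band n t s) (band n r q) :=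
  (commute_band_of_sigma h₃ fun _ h _ =>
    (sigma_commute_band_of_lt h₁ (by omega)).symm).symm

theorem band_commute_of_nested {q r s t : ℕ} (hq : 1 ≤ q) (h₁ : q < r) (h₂ : r < s) (h₃ : s < t)
    (ht : t ≤ n) : Commute (band n t q) (band n s r) :=
  commute_band_of_sigma h₂ fun _ _ _ =>
    (sigma_commute_band_of_mem hq (by omega) (by omega) ht).symm

/-- Conjugation by σ_sσ_{s+1} carries the pair σ_s, a_{sr} to σ_{s+1}, a_{(s+1)r}. -/
theorem sigma_band_braid {r s : ℕ} (hr : 1 ≤ r) (hrs : r < s) (hs : s < n) :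
    sigma n s * band n s r * sigma n s = band n s r * sigma n s * band n s r := by
  induction s, hrs using Nat.le_induction with
  | base =>
    rw [Nat.succ_eq_add_one, band_succ_self]
    exact (sigma_braid hr hs).symm
  | succ s hrs ih =>
    have hc : sigma n (s + 1) * band n s r = band n s r * sigma n (s + 1) :=
      sigma_commute_band_of_lt hrs (by omega)
    have h₁ : sigma n (s + 1) = MulAut.conj (sigma n s * sigma n (s + 1)) (sigma n s) := by
      rw [MulAut.conj_apply, sigma_braid (by omega) hs]
      group
    have h₂ : band n (s + 1) r = MulAut.conj (sigma n s * sigma n (s + 1)) (band n s r) := by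
      rw [MulAut.conj_apply, mul_assoc (sigma n s), hc, band_succ hrs]
      group
    generalize MulAut.conj (sigma n s * sigma n (s + 1)) = f at h₁ h₂
    have h := congrArg f (ih (by omega))
    simpa only [map_mul, ← h₁, ← h₂] using h

/-- Conjugation by σ_t fixes a_{sr} and raises the upper index t of the other two bands. -/
theorem band_mul_band {r s t : ℕ} (hrs : r < s) (hst : s < t) :
    band n t s * band n s r = band n t r * band n t s := by
  induction t, hst using Nat.le_induction with
  | base =>
    rw [Nat.succ_eq_add_one, band_succ_self]
    exact sigma_mul_band hrs
  | succ t hst ih =>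
    have hc : band n s r = sigma n t * band n s r * (sigma n t)⁻¹ := by
      rw [(sigma_commute_band_of_lt hrs hst).eq, mul_inv_cancel_right]
    rw [band_succ hst, band_succ (hrs.trans hst), hc, ← MulAut.conj_apply, ← MulAut.conj_apply,
      ← MulAut.conj_apply, ← map_mul, ih, map_mul]

theorem band_mul_band' {r s t : ℕ} (hr : 1 ≤ r) (hrs : r < s) (hst : s < t) (ht : t ≤ n) :
    band n s r * band n t r = band n t s * band n s r := by
  induction t, hst using Nat.le_induction with
  | base =>
    rw [Nat.succ_eq_add_one, band_succ_self, band_succ hrs, ← mul_assoc, ← mul_assoc,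
      ← sigma_band_braid hr hrs (by omega), mul_inv_cancel_right]
  | succ t hst ih =>
    have hc : band n s r = sigma n t * band n s r * (sigma n t)⁻¹ := by
      rw [(sigma_commute_band_of_lt hrs hst).eq, mul_inv_cancel_right]
    rw [band_succ hst, band_succ (hrs.trans hst), hc, ← MulAut.conj_apply, ← MulAut.conj_apply,
      ← MulAut.conj_apply, ← map_mul, ih (by omega), map_mul]

/-! ### Noncrossing partitions as braids. -/

namespace NC

/-- The braid represented by a noncrossing partition. -/
noncomputable def lift (b : NC n) : BraidGroup n :=
  open Classical in
  if h : b = ⊥ then 1 else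
    let s := (exists_rel_of_ne_bot h).choose
    let t := (exists_rel_of_ne_bot h).choose_spec.choose
    have hst := (exists_rel_of_ne_bot h).choose_spec.choose_spec
    band n t s * lift (b ⊓ (atom s t hst.1 hst.2.1 hst.2.2.1).compl)
termination_by wellFounded_lt.wrap b
decreasing_by exact inf_compl_lt (atom_le_iff.2 hst.2.2.2) atom_ne_bot

theorem lift_bot : lift (⊥ : NC n) = 1 := by
  rw [lift, dif_pos rfl]

theorem exists_lift_eq {b : NC n} (h : b ≠ ⊥) : ∃ s t hs hst ht, b.rel s t ∧
    lift b = band n t s * lift (b ⊓ (atom s t hs hst ht).compl) := by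
  have hst := (exists_rel_of_ne_bot h).choose_spec.choose_spec
  refine ⟨_, _, hst.1, hst.2.1, hst.2.2.1, hst.2.2.2, ?_⟩
  rw [lift, dif_neg h]

/-- `lift` peels off a chosen atom; the choice is immaterial. Disjoint or nested pairs give
commuting bands, pairs sharing an end are compared by the three-point relations. -/
theorem lift_indep {b : NC n}
    (ih : ∀ c < b, ∀ {s t} (hs : 1 ≤ s) (hst : s < t) (ht : t ≤ n), c.rel s t →
      lift c = band n t s * lift (c ⊓ (atom s t hs hst ht).compl))
    {s t s' t' : ℕ} (hs : 1 ≤ s) (hst : s < t) (ht : t ≤ n) (hs' : 1 ≤ s') (hst' : s' < t')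
    (ht' : t' ≤ n) (h : b.rel s t) (h' : b.rel s' t') (hss : s ≤ s') :
    band n t s * lift (b ⊓ (atom s t hs hst ht).compl)
      = band n t' s' * lift (b ⊓ (atom s' t' hs' hst' ht').compl) := by
  have step : ∀ {p q r u : ℕ} (hp : 1 ≤ p) (hpq : p < q) (hq : q ≤ n) (hr : 1 ≤ r) (hru : r < u)
      (hu : u ≤ n), b.rel p q → b.rel r u → ((p < r ∧ r ≤ q) ↔ (p < u ∧ u ≤ q)) →
      band n q p * lift (b ⊓ (atom p q hp hpq hq).compl) = band n q p * band n u r *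
        lift (b ⊓ (atom p q hp hpq hq).compl ⊓ (atom r u hr hru hu).compl) := by
    intro p q r u hp hpq hq hr hru hu h₁ h₂ h₃
    rw [mul_assoc, ih _ (inf_compl_lt (atom_le_iff.2 h₁) atom_ne_bot) hr hru hu
      (inf_compl_atom_rel.2 ⟨h₂, h₃⟩)]
  have triple : ∀ {p q r : ℕ} (hp : 1 ≤ p) (hpq : p < q) (hqr : q < r) (hr : r ≤ n),
      b.rel p q → b.rel q r →
      band n q p * lift (b ⊓ (atom p q hp hpq (by omega)).compl)
        = band n r p * lift (b ⊓ (atom p r hp (by omega) hr).compl) ∧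
      band n r q * lift (b ⊓ (atom q r (by omega) hqr hr).compl)
        = band n r p * lift (b ⊓ (atom p r hp (by omega) hr).compl) := by
    intro p q r hp hpq hqr hr h₁ h₂
    have h₃ := b.trans h₁ h₂
    rw [step hp hpq (by omega) hp (by omega) hr h₁ h₃ (by omega),
      step hp (by omega) hr (by omega) hqr hr h₃ h₂ (by omega),
      step (by omega) hqr hr hp hpq (by omega) h₂ h₁ (by omega),
      band_mul_band' hp hpq hqr hr, band_mul_band hpq hqr]
    constructor
    all_goals
      congr 2
      ext x y
      simp only [inf_compl_atom_rel, and_assoc]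
      refine and_congr_right fun _ => ?_
      omega
  have comm : ∀ {p q r u : ℕ} (hp : 1 ≤ p) (hpq : p < q) (hq : q ≤ n) (hr : 1 ≤ r) (hru : r < u)
      (hu : u ≤ n), b.rel p q → b.rel r u → ((p < r ∧ r ≤ q) ↔ (p < u ∧ u ≤ q)) →
      ((r < p ∧ p ≤ u) ↔ (r < q ∧ q ≤ u)) → Commute (band n q p) (band n u r) →
      band n q p * lift (b ⊓ (atom p q hp hpq hq).compl)
        = band n u r * lift (b ⊓ (atom r u hr hru hu).compl) := by
    intro p q r u hp hpq hq hr hru hu h₁ h₂ h₃ h₄ hc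
    rw [step hp hpq hq hr hru hu h₁ h₂ h₃, step hr hru hu hp hpq hq h₂ h₁ h₄, hc.eq,
      inf_right_comm]
  rcases hss.eq_or_lt with rfl | hss
  · rcases lt_trichotomy t t' with h₁ | rfl | h₁
    · exact (triple hs hst h₁ ht' h (b.trans (b.symm h) h')).1
    · rfl
    · exact (triple hs hst' h₁ ht h' (b.trans (b.symm h') h)).1.symm
  · rcases lt_trichotomy t s' with h₁ | rfl | h₁
    · exact comm hs hst ht hs' hst' ht' h h' (by omega) (by omega)
        (band_commute_of_disjoint hst h₁ hst').symm
    · exact (triple hs hst hst' ht' h h').1.trans (triple hs hst hst' ht' h h').2.symm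
    · rcases lt_trichotomy t t' with h₂ | rfl | h₂
      · have h₃ := b.noncrossing hss h₁ h₂ h h'
        have e₁ := triple hs hss h₁ ht h₃ (b.trans (b.symm h₃) h)
        have e₂ := triple hs hss hst' ht' h₃ h'
        exact e₁.1.symm.trans (e₂.1.trans e₂.2.symm)
      · exact (triple hs hss hst' ht (b.trans h (b.symm h')) h').2.symm
      · exact comm hs hst ht hs' hst' ht' h h' (by omega) (by omega)
          (band_commute_of_nested hs hss hst' h₂ ht)

theorem lift_eq {b : NC n} {s t : ℕ} (hs : 1 ≤ s) (hst : s < t) (ht : t ≤ n) (h : b.rel s t) :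
    lift b = band n t s * lift (b ⊓ (atom s t hs hst ht).compl) := by
  induction b using WellFoundedLT.induction generalizing s t with
  | _ b ih =>
  have hb : b ≠ ⊥ := by
    rintro rfl
    exact hst.ne h
  obtain ⟨s', t', hs', hst', ht', h', e⟩ := exists_lift_eq hb
  rw [e]
  rcases le_total s s' with hss | hss
  · exact (lift_indep ih hs hst ht hs' hst' ht' h h' hss).symm
  · exact lift_indep ih hs' hst' ht' hs hst ht h' h hss

/-- Induction on noncrossing partitions, splitting off an atom. -/
theorem induction_atom {C : NC n → Prop} (bot : C ⊥)
    (mul : ∀ (b : NC n) (s t : ℕ) (hs : 1 ≤ s) (hst : s < t) (ht : t ≤ n), b.rel s t →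
      C (b ⊓ (atom s t hs hst ht).compl) → C b) (b : NC n) : C b := by
  induction b using WellFoundedLT.induction with
  | _ b ih =>
  by_cases hb : b = ⊥
  · exact hb ▸ bot
  · obtain ⟨s, t, hs, hst, ht, h⟩ := exists_rel_of_ne_bot hb
    exact mul b s t hs hst ht h (ih _ (inf_compl_lt (atom_le_iff.2 h) atom_ne_bot))

/-- Strip the atoms of `a` one at a time from both sides; an atom below `a` is also below `b`. -/
theorem lift_mul_lift {a b : NC n} (hab : a ≤ b) : lift a * lift (b ⊓ a.compl) = lift b := by
  induction a using induction_atom generalizing b with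
  | bot => rw [lift_bot, one_mul, compl_bot, inf_top_eq]
  | mul a s t hs hst ht h ih =>
    rw [lift_eq hs hst ht h, lift_eq hs hst ht (hab h), mul_assoc,
      ← ih (inf_le_inf_right _ hab), inf_compl_inf_compl (atom_le_iff.2 h)]

theorem lift_mul_prod {u v : NC n} (h : v ≤ u.compl) : lift u * lift v = lift (prod u v) := by
  rw [← lift_mul_lift (le_prod_left u v), prod_inf h]

theorem lift_atom {s t : ℕ} (hs : 1 ≤ s) (hst : s < t) (ht : t ≤ n) :
    lift (atom s t hs hst ht) = band n t s := by
  rw [lift_eq hs hst ht (atom_le_iff.1 le_rfl), inf_compl_self, lift_bot, mul_one]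

theorem band_mem_positive {s t : ℕ} (hs : 1 ≤ s) (hst : s < t) (ht : t ≤ n) :
    band n t s ∈ positive n := Submonoid.subset_closure ⟨t, s, hs, hst, ht, rfl⟩

theorem lift_mem_positive (b : NC n) : lift b ∈ positive n := by
  induction b using induction_atom with
  | bot => rw [lift_bot]; exact one_mem _
  | mul b s t hs hst ht h ih =>
    rw [lift_eq hs hst ht h]
    exact mul_mem (band_mem_positive hs hst ht) ih

/-- The noncrossing partition whose only nontrivial block is `{1, …, k}`. -/
def initial (k : ℕ) (hk : k ≤ n) : NC n where
  rel x y := x = y ∨ (1 ≤ x ∧ x ≤ k ∧ 1 ≤ y ∧ y ≤ k)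
  refl x := Or.inl rfl
  symm := by omega
  trans := by omega
  bdd := by omega
  noncrossing := by omega

theorem lift_initial (k : ℕ) (hk : k ≤ n) (h₁ : 1 ≤ k) :
    lift (initial k hk) = ((List.Ico 1 k).reverse.map (fun i => band n (i + 1) i)).prod := by
  induction k, h₁ using Nat.le_induction with
  | base =>
    have : initial 1 hk = ⊥ := by
      ext x y
      change (x = y ∨ (1 ≤ x ∧ x ≤ 1 ∧ 1 ≤ y ∧ y ≤ 1)) ↔ x = y
      omega
    rw [this, lift_bot]
    simp
  | succ k h₁ ih =>
    have e : initial (k + 1) hk ⊓ (atom k (k + 1) h₁ (by omega) hk).compl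
        = initial k (by omega) := by
      ext x y
      rw [inf_compl_atom_rel]
      change (x = y ∨ (1 ≤ x ∧ x ≤ k + 1 ∧ 1 ≤ y ∧ y ≤ k + 1)) ∧ _ ↔
        x = y ∨ (1 ≤ x ∧ x ≤ k ∧ 1 ≤ y ∧ y ≤ k)
      omega
    rw [lift_eq (s := k) (t := k + 1) h₁ (by omega) hk (Or.inr (by omega)), e, ih,
      List.Ico.succ_top h₁]
    simp

theorem lift_top (hn : 1 ≤ n) : lift (⊤ : NC n) = delta n := lift_initial n le_rfl hn

end NC
end Braid

namespace Braid

variable {n : ℕ}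

/-! ### The representation and greatest left divisors. -/

theorem exists_hom_of_artin {G : Type*} [Group G] (f : {i : ℕ // 1 ≤ i ∧ i < n} → G)
    (hc : ∀ i j : {i : ℕ // 1 ≤ i ∧ i < n}, (i : ℕ) + 1 < j → f i * f j = f j * f i)
    (hb : ∀ i j : {i : ℕ // 1 ≤ i ∧ i < n}, (i : ℕ) + 1 = j → f i * f j * f i = f j * f i * f j) :
    ∃ φ : BraidGroup n →* G, ∀ i (h : 1 ≤ i ∧ i < n), φ (sigma n i) = f ⟨i, h⟩ := by
  have key : ∀ r ∈ artinRels n, FreeGroup.lift f r = 1 := by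
    rintro r ⟨i, j, ⟨h, rfl⟩ | ⟨h, rfl⟩⟩
    · rw [map_mul, map_inv, mul_inv_eq_one]
      simp only [map_mul, FreeGroup.lift_apply_of]
      rcases lt_abs.1 h with h | h
      · exact (hc j i (by omega)).symm
      · exact hc i j (by omega)
    · rw [map_mul, map_inv, mul_inv_eq_one]
      simp only [map_mul, FreeGroup.lift_apply_of]
      rcases (abs_eq zero_le_one).1 h with h | h
      · exact (hb j i (by omega)).symm
      · exact hb i j (by omega)
  refine ⟨PresentedGroup.toGroup key, fun i h => ?_⟩
  rw [sigma, dif_pos h]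
  exact PresentedGroup.toGroup.of key

namespace NC

/-- All the products are joins of atoms, and the joins agree because their complements do. -/
theorem fracPerm_atom_mul {r s t : ℕ} (hr : 1 ≤ r) (hrs : r < s) (hst : s < t) (ht : t ≤ n) :
    fracPerm (atom s t (by omega) hst ht) * fracPerm (atom r s hr hrs (by omega))
      = fracPerm (atom r t hr (by omega) ht) * fracPerm (atom s t (by omega) hst ht) ∧
    fracPerm (atom r s hr hrs (by omega)) * fracPerm (atom r t hr (by omega) ht)
      = fracPerm (atom s t (by omega) hst ht) * fracPerm (atom r s hr hrs (by omega)) := by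
  rw [fracPerm_mul_prod, fracPerm_mul_prod, fracPerm_mul_prod]
  · constructor
    all_goals
      congr 1
      refine compl_injective ?_
      rw [compl_prod, compl_prod]
      ext x y
      simp only [inf_rel, compl_atom_rel]
      omega
  all_goals
    rw [atom_le_iff, compl_atom_rel]
    omega

theorem fracPerm_atom_comm {p q r s : ℕ} (hp : 1 ≤ p) (hpq : p < q) (hqr : q < r) (hrs : r < s)
    (hs : s ≤ n) :
    fracPerm (atom p q hp hpq (by omega)) * fracPerm (atom r s (by omega) hrs hs)
      = fracPerm (atom r s (by omega) hrs hs) * fracPerm (atom p q hp hpq (by omega)) := by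
  rw [fracPerm_mul_prod, fracPerm_mul_prod, prod, prod, inf_comm]
  all_goals
    rw [atom_le_iff, compl_atom_rel]
    omega

theorem exists_rep (n : ℕ) : ∃ ρ : BraidGroup n →* Equiv.Perm (Frac n),
    ∀ u, ρ (lift u) = fracPerm u := by
  obtain ⟨ρ, hρ⟩ := exists_hom_of_artin (n := n)
    (fun i => fracPerm (atom i (i + 1) i.2.1 (Nat.lt_succ_self _) i.2.2))
    (fun i j h => fracPerm_atom_comm _ _ h _ _) (fun i j h => by
      obtain ⟨j, hj⟩ := j
      dsimp only at h
      subst h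
      obtain ⟨h₁, h₂⟩ := fracPerm_atom_mul (n := n) i.2.1 (Nat.lt_succ_self _)
        (Nat.lt_succ_self _) hj.2
      exact (mul_assoc _ _ _).trans ((congrArg (_ * ·) h₁).trans
        ((mul_assoc _ _ _).symm.trans (congrArg (· * _) h₂))))
  have hband : ∀ s t (hs : 1 ≤ s) (hst : s < t) (ht : t ≤ n),
      ρ (band n t s) = fracPerm (atom s t hs hst ht) := by
    intro s t hs hst
    induction t, hst using Nat.le_induction with
    | base =>
      intro ht
      exact (congrArg ρ (band_succ_self s)).trans (hρ s ⟨hs, ht⟩)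
    | succ t hst ih =>
      intro ht
      rw [band_succ hst, map_mul, map_mul, map_inv, ih (by omega), hρ t ⟨by omega, ht⟩,
        mul_inv_eq_iff_eq_mul]
      exact (fracPerm_atom_mul hs hst (Nat.lt_succ_self _) ht).1
  refine ⟨ρ, fun u => ?_⟩
  induction u using induction_atom with
  | bot =>
    rw [lift_bot, map_one]
    have h := fracPerm_mul (n := n) (le_refl ⊥)
    rw [inf_compl_self] at h
    exact (mul_eq_left.1 h).symm
  | mul b s t hs hst ht h ih =>
    rw [lift_eq hs hst ht h, map_mul, hband s t hs hst ht, ih, fracPerm_mul (atom_le_iff.2 h)]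

/-- The representation of the braid group on `Frac n`. -/
noncomputable def rep (n : ℕ) : BraidGroup n →* Equiv.Perm (Frac n) := (exists_rep n).choose

theorem rep_lift (u : NC n) : rep n (lift u) = fracPerm u := (exists_rep n).choose_spec u

/-- The braid represented by a sequence of noncrossing partitions. -/
noncomputable def eval (x : List (NC n)) : BraidGroup n := (x.map lift).prod

theorem eval_cons (h : NC n) (t : List (NC n)) : eval (h :: t) = lift h * eval t :=
  List.prod_cons

theorem eval_act (s : NC n) (x : List (NC n)) : eval (act s x) = lift s * eval x := by
  induction x generalizing s with
  | nil =>
    by_cases hs : s = ⊥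
    · rw [hs, act_bot_nil, lift_bot, one_mul]
    · rw [act_nil hs, eval_cons]
  | cons h t ih =>
    rw [act_cons, eval_cons, ih, ← lift_mul_prod inf_le_right, eval_cons,
      ← lift_mul_lift (inf_le_left : h ⊓ s.compl ≤ h)]
    simp only [mul_assoc]

theorem eval_mem_positive (x : List (NC n)) : eval x ∈ positive n :=
  Submonoid.list_prod_mem _ fun _ h => by
    obtain ⟨u, -, rfl⟩ := List.mem_map.1 h
    exact lift_mem_positive u

theorem length_le_length_act (s : NC n) (x : List (NC n)) : x.length ≤ (act s x).length := by
  induction x generalizing s with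
  | nil => exact Nat.zero_le _
  | cons h t ih => exact Nat.succ_le_succ (ih _)

/-- Positive braids are generated from the identity by atoms on the left. -/
theorem positive_induction {C : ∀ P : BraidGroup n, P ∈ positive n → Prop} (one : C 1 (one_mem _))
    (mul : ∀ s t (hs : 1 ≤ s) (hst : s < t) (ht : t ≤ n) (P : BraidGroup n)
      (hP : P ∈ positive n), C P hP →
        C (lift (atom s t hs hst ht) * P) (mul_mem (lift_mem_positive _) hP))
    {P : BraidGroup n} (hP : P ∈ positive n) : C P hP := by
  induction hP using Submonoid.closure_induction_left with
  | one => exact one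
  | mul_left x hx y hy ih =>
    obtain ⟨t, s, hs, hst, ht, rfl⟩ := hx
    have h := mul s t hs hst ht y hy ih
    simp only [lift_atom] at h
    exact h

/-- Positive braids preserve honest sequences, with no inverse of the central element. That lengths
never drop is what later confines divisors of δ to one entry. -/
theorem exists_rep_ofBase {P : BraidGroup n} (hP : P ∈ positive n) (x : Normal n) :
    ∃ y : Normal n, rep n P (Telescope.ofBase x) = Telescope.ofBase y ∧
      eval y.1 = P * eval x.1 ∧ x.1.length ≤ y.1.length := by
  induction hP using positive_induction with
  | one => exact ⟨x, by rw [map_one]; rfl, (one_mul _).symm, le_rfl⟩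
  | mul s t hs hst ht P hP ih =>
    obtain ⟨y, h₁, h₂, h₃⟩ := ih
    refine ⟨Normal.act (atom s t hs hst ht) y, ?_, ?_, h₃.trans (length_le_length_act _ _)⟩
    · rw [map_mul, rep_lift, Equiv.Perm.mul_apply, h₁, fracPerm_ofBase]
    · rw [mul_assoc, ← h₂]
      exact eval_act _ _

/-- The empty sequence. -/
def Normal.nil : Normal n := ⟨[], trivial⟩

/-- Every positive braid has a greatest left divisor among the noncrossing partitions. -/
theorem exists_head {P : BraidGroup n} (hP : P ∈ positive n) :
    ∃ h : NC n, ∀ s : NC n, (lift s)⁻¹ * P ∈ positive n ↔ s ≤ h := by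
  obtain ⟨⟨x, hx⟩, hx₁, hx₂, -⟩ := exists_rep_ofBase hP Normal.nil
  replace hx₂ : eval x = P := hx₂.trans (mul_one P)
  -- If P = sQ, the normal form of P is s acting on that of Q, so its head lies above s.
  have key : ∀ s : NC n, (lift s)⁻¹ * P ∈ positive n → ∃ y, x = act s y := by
    intro s hs
    obtain ⟨y, hy, -⟩ := exists_rep_ofBase hs Normal.nil
    refine ⟨y.1, congrArg Subtype.val (Telescope.ofBase_injective (D := Normal.central n)
      (hD := Normal.central_injective) (a₁ := ⟨x, hx⟩) (a₂ := Normal.act s y) ?_)⟩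
    rw [← hx₁, ← fracPerm_ofBase, ← hy, ← rep_lift, ← Equiv.Perm.mul_apply, ← map_mul,
      mul_inv_cancel_left]
  cases x with
  | nil =>
    refine ⟨⊥, fun s => ⟨fun hs => ?_, fun hs => ?_⟩⟩
    · obtain ⟨y, hy⟩ := key s hs
      by_contra hne
      cases y with
      | nil =>
        rw [act_nil (fun h => hne h.le)] at hy
        cases hy
      | cons h t => cases hy
    · rwa [le_bot_iff.1 hs, lift_bot, inv_one, one_mul]
  | cons h t =>
    refine ⟨h, fun s => ⟨fun hs => ?_, fun hs => ?_⟩⟩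
    · obtain ⟨y, hy⟩ := key s hs
      cases y with
      | nil =>
        by_cases hne : s = ⊥
        · exact hne.le.trans bot_le
        · rw [act_nil hne] at hy
          exact (List.cons.inj hy).1.ge
      | cons h' t' =>
        rw [act_cons] at hy
        exact (le_prod_left _ _).trans (List.cons.inj hy).1.ge
    · rw [← hx₂, eval_cons, ← lift_mul_lift hs, mul_assoc, inv_mul_cancel_left]
      exact mul_mem (lift_mem_positive _) (eval_mem_positive _)

theorem lift_prod_dvd {P : BraidGroup n} (hP : P ∈ positive n) {u v : NC n}
    (hu : (lift u)⁻¹ * P ∈ positive n) (hv : (lift v)⁻¹ * P ∈ positive n) :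
    (lift (prod u v))⁻¹ * P ∈ positive n := by
  obtain ⟨h, hh⟩ := exists_head hP
  rw [hh] at *
  exact prod_le hu hv

/-- If the result still has at most one entry, s absorbed all of k, which means k ≤ K(s). -/
theorem act_act_nil {s k k' : NC n} (h : act s (act k []) = act k' []) :
    k ≤ s.compl ∧ prod s k = k' := by
  by_cases hk : k = ⊥
  · subst hk
    rw [act_bot_nil] at h
    refine ⟨bot_le, ?_⟩
    rw [prod_bot_right]
    by_cases hs : s = ⊥ <;> by_cases hk' : k' = ⊥
    · rw [hs, hk']
    · rw [hs, act_bot_nil, act_nil hk'] at h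
      cases h
    · rw [hk', act_bot_nil, act_nil hs] at h
      cases h
    · rw [act_nil hk', act_nil hs] at h
      exact (List.cons.inj h).1
  · rw [act_nil hk, act_cons] at h
    by_cases hk' : k' = ⊥
    · rw [hk', act_bot_nil] at h
      cases h
    rw [act_nil hk'] at h
    obtain ⟨h₁, h₂⟩ := List.cons.inj h
    have h₃ : k ⊓ s.compl = k := by
      refine eq_of_inf_compl_eq_bot inf_le_left ?_
      by_contra hne
      rw [act_nil hne] at h₂
      cases h₂
    rw [h₃] at h₁
    exact ⟨inf_eq_left.1 h₃, h₁⟩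

theorem exists_eq_act_nil {x : Normal n} (h : x.1.length ≤ 1) :
    ∃ k, x = Normal.act k Normal.nil := by
  obtain ⟨x, hx⟩ := x
  match x, hx, h with
  | [], _, _ => exact ⟨⊥, Subtype.ext act_bot_nil.symm⟩
  | [k], hx, _ => exact ⟨k, Subtype.ext hx.1.symm⟩

theorem length_act_nil_le (k : NC n) : (act k []).length ≤ 1 := by
  by_cases hk : k = ⊥
  · rw [hk, act_bot_nil]
    exact Nat.zero_le _
  · rw [act_nil hk]
    rfl

theorem exists_lift_eq_of_rep {A : BraidGroup n} (hA : A ∈ positive n) {k : NC n} :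
    ∀ {k' : NC n}, rep n A (Telescope.ofBase (Normal.act k Normal.nil))
      = Telescope.ofBase (Normal.act k' Normal.nil) → ∃ u ≤ k', A = lift u := by
  induction hA using positive_induction with
  | one => exact fun _ => ⟨⊥, bot_le, lift_bot.symm⟩
  | mul s t hs hst ht A hA ih =>
    intro k' h
    obtain ⟨x, hx, -⟩ := exists_rep_ofBase hA (Normal.act k Normal.nil)
    rw [map_mul, Equiv.Perm.mul_apply, hx, rep_lift, fracPerm_ofBase] at h
    have h' := congrArg Subtype.val (Telescope.ofBase_injective h)
    obtain ⟨k₁, rfl⟩ := exists_eq_act_nil (x := x)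
      ((length_le_length_act _ _).trans ((congrArg List.length h').trans_le
        (length_act_nil_le k')))
    obtain ⟨u, hu, rfl⟩ := ih hx
    obtain ⟨h₁, rfl⟩ := act_act_nil h'
    exact ⟨prod _ u, prod_le (le_prod_left _ _) (hu.trans (le_prod_right _ _)),
      lift_mul_prod (hu.trans h₁)⟩

end NC

/-! ### Canonical factors are exactly the lifts of noncrossing partitions. -/

open NC

theorem le_one_iff {P : BraidGroup n} : le 1 P ↔ P ∈ positive n := by
  constructor
  · rintro ⟨P₁, h₁, P₂, h₂, rfl⟩
    rw [mul_one]
    exact mul_mem h₁ h₂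
  · exact fun h => ⟨P, h, 1, one_mem _, by simp⟩

theorem isCanonicalFactor_iff (hn : 1 ≤ n) {A : BraidGroup n} :
    IsCanonicalFactor A ↔ ∃ u : NC n, A = lift u := by
  constructor
  · rintro ⟨hA, P₁, h₁, P₂, h₂, h⟩
    rw [le_one_iff] at hA
    obtain ⟨x₂, e₂, -, -⟩ := exists_rep_ofBase h₂ Normal.nil
    obtain ⟨x₁, e₁, -, l₁⟩ := exists_rep_ofBase hA x₂
    obtain ⟨x₀, e₀, -, l₀⟩ := exists_rep_ofBase h₁ x₁
    -- Applying δ = P₁AP₂ to the empty sequence ends in length at most 1, so every intermediate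
    -- sequence is that short.
    have h₀ : x₀ = Normal.act ⊤ Normal.nil := by
      refine Telescope.ofBase_injective (D := Normal.central n)
        (hD := Normal.central_injective) ?_
      rw [← fracPerm_ofBase, ← rep_lift, lift_top hn, h, map_mul, map_mul,
        Equiv.Perm.mul_apply, Equiv.Perm.mul_apply, e₂, e₁, e₀]
    have l : x₀.1.length ≤ 1 := h₀ ▸ length_act_nil_le ⊤
    obtain ⟨k₁, rfl⟩ := exists_eq_act_nil (l₀.trans l)
    obtain ⟨k₂, rfl⟩ := exists_eq_act_nil (l₁.trans (l₀.trans l))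
    obtain ⟨u, -, hu⟩ := exists_lift_eq_of_rep hA e₁
    exact ⟨u, hu⟩
  · rintro ⟨u, rfl⟩
    refine ⟨le_one_iff.2 (lift_mem_positive u), 1, one_mem _, lift (⊤ ⊓ u.compl),
      lift_mem_positive _, ?_⟩
    rw [one_mul, lift_mul_lift le_top, lift_top hn]

end Braid

namespace Braid

open NC

variable {n : ℕ}

/-! ### Reversal and common left multiples. -/

/-- The flip i ↦ n - i accompanies the reversal of words so that band generators go to band
generators and δ is fixed. -/
theorem exists_rev (n : ℕ) : ∃ φ : BraidGroup n →* (BraidGroup n)ᵐᵒᵖ,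
    ∀ i, 1 ≤ i → i < n → φ (sigma n i) = MulOpposite.op (sigma n (n - i)) := by
  obtain ⟨φ, hφ⟩ := exists_hom_of_artin (n := n)
    (fun i => MulOpposite.op (sigma n (n - i)))
    (fun i j h => congrArg MulOpposite.op
      (sigma_commute_of_lt (n := n) (i := n - j) (j := n - i) (by have := j.2; omega)).eq)
    (fun i j h => by
      have hb := sigma_braid (n := n) (i := n - j) (by have := j.2; omega)
        (by have := i.2; have := j.2; omega)
      rw [show n - (j : ℕ) + 1 = n - i by have := j.2; omega] at hb
      simp only [← MulOpposite.op_mul, ← mul_assoc]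
      exact congrArg MulOpposite.op hb.symm)
  exact ⟨φ, fun i h₁ h₂ => hφ i ⟨h₁, h₂⟩⟩

/-- The anti-automorphism of the braid group with `σ_i ↦ σ_{n-i}`. -/
noncomputable def rev (g : BraidGroup n) : BraidGroup n := ((exists_rev n).choose g).unop

theorem rev_sigma {i : ℕ} (h₁ : 1 ≤ i) (h₂ : i < n) : rev (sigma n i) = sigma n (n - i) :=
  congrArg MulOpposite.unop ((exists_rev n).choose_spec i h₁ h₂)

theorem rev_mul (g h : BraidGroup n) : rev (g * h) = rev h * rev g :=
  congrArg MulOpposite.unop (map_mul _ g h)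

theorem rev_one : rev (1 : BraidGroup n) = 1 := congrArg MulOpposite.unop (map_one _)

theorem rev_inv (g : BraidGroup n) : rev g⁻¹ = (rev g)⁻¹ :=
  congrArg MulOpposite.unop (map_inv _ g)

theorem rev_rev (g : BraidGroup n) : rev (rev g) = g := by
  have h : MonoidHom.mk' (fun g : BraidGroup n => rev (rev g))
      (fun a b => by rw [rev_mul, rev_mul]) = MonoidHom.id _ := by
    refine PresentedGroup.ext fun i => ?_
    have hi := i.2
    have e : (PresentedGroup.of i : BraidGroup n) = sigma n i := by rw [sigma, dif_pos hi]
    change rev (rev (PresentedGroup.of i)) = PresentedGroup.of i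
    rw [e, rev_sigma hi.1 hi.2, rev_sigma (by omega) (by omega)]
    congr 1
    omega
  exact DFunLike.congr_fun h g

theorem rev_band {s t : ℕ} (hs : 1 ≤ s) (hst : s < t) (ht : t ≤ n) :
    rev (band n t s) = band n (n + 1 - s) (n + 1 - t) := by
  induction t, hst using Nat.le_induction with
  | base =>
    have e : n + 1 - s = n - s + 1 := by omega
    rw [Nat.succ_eq_add_one, band_succ_self, rev_sigma hs ht, Nat.add_sub_add_right, e,
      band_succ_self]
  | succ t hst ih =>
    have h := band_mul_band' (n := n) (r := n - t) (s := n - t + 1) (t := n + 1 - s)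
      (by omega) (by omega) (by omega) (by omega)
    rw [band_succ_self] at h
    rw [band_succ hst, rev_mul, rev_mul, rev_inv, rev_sigma (by omega) ht, ih (by omega),
      inv_mul_eq_iff_eq_mul, Nat.add_sub_add_right, h, show n - t + 1 = n + 1 - t by omega]

theorem rev_mem_positive {P : BraidGroup n} (hP : P ∈ positive n) : rev P ∈ positive n := by
  induction hP using Submonoid.closure_induction with
  | mem x hx =>
    obtain ⟨t, s, hs, hst, ht, rfl⟩ := hx
    rw [rev_band hs hst ht]
    exact band_mem_positive (by omega) (by omega) (by omega)
  | one => rw [rev_one]; exact one_mem _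
  | mul x y _ _ hx hy => rw [rev_mul]; exact mul_mem hy hx

theorem rev_prod_sigma {k : ℕ} (h₁ : 1 ≤ k) (hk : k ≤ n) :
    rev ((List.Ico 1 k).reverse.map (sigma n)).prod
      = ((List.Ico (n + 1 - k) n).reverse.map (sigma n)).prod := by
  induction k, h₁ using Nat.le_induction with
  | base => simp [rev_one]
  | succ k h₁ ih =>
    rw [List.Ico.succ_top h₁, List.Ico.eq_cons (show n + 1 - (k + 1) < n by omega),
      show n + 1 - (k + 1) + 1 = n + 1 - k by omega, List.reverse_append, List.map_append,
      List.prod_append, rev_mul, ih (by omega)]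
    simp [rev_sigma (n := n) h₁ (by omega)]

theorem rev_delta (hn : 1 ≤ n) : rev (delta n) = delta n := by
  have h := rev_prod_sigma (n := n) hn le_rfl
  rw [Nat.add_sub_cancel_left] at h
  simpa only [delta, band_succ_self] using h

theorem IsCanonicalFactor.rev {A : BraidGroup n} (hn : 1 ≤ n) (hA : IsCanonicalFactor A) :
    IsCanonicalFactor (rev A) := by
  obtain ⟨h₁, P₁, hP₁, P₂, hP₂, h⟩ := hA
  refine ⟨le_one_iff.2 (rev_mem_positive (le_one_iff.1 h₁)), Braid.rev P₂, rev_mem_positive hP₂,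
    Braid.rev P₁, rev_mem_positive hP₁, ?_⟩
  rw [← rev_delta hn, h, rev_mul, rev_mul, mul_assoc]

/-- Canonical factors have a common right multiple that divides all common right multiples. -/
theorem exists_canonical_right_multiple (hn : 1 ≤ n) {x y Z : BraidGroup n}
    (hx : IsCanonicalFactor x) (hy : IsCanonicalFactor y) (hZ : Z ∈ positive n)
    (hxZ : x⁻¹ * Z ∈ positive n) (hyZ : y⁻¹ * Z ∈ positive n) :
    ∃ L, IsCanonicalFactor L ∧ x⁻¹ * L ∈ positive n ∧ y⁻¹ * L ∈ positive n ∧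
      L⁻¹ * Z ∈ positive n := by
  obtain ⟨u, rfl⟩ := (isCanonicalFactor_iff hn).1 hx
  obtain ⟨v, rfl⟩ := (isCanonicalFactor_iff hn).1 hy
  refine ⟨lift (prod u v), (isCanonicalFactor_iff hn).2 ⟨_, rfl⟩, ?_, ?_,
    lift_prod_dvd hZ hxZ hyZ⟩
  · rw [← lift_mul_lift (le_prod_left u v), inv_mul_cancel_left]
    exact lift_mem_positive _
  · rw [← lift_mul_lift (le_prod_right u v), inv_mul_cancel_left]
    exact lift_mem_positive _

/-- Canonical factors have a common left multiple that divides all common left multiples. -/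
theorem exists_canonical_left_multiple (hn : 1 ≤ n) {x y Z : BraidGroup n}
    (hx : IsCanonicalFactor x) (hy : IsCanonicalFactor y) (hZ : Z ∈ positive n)
    (hxZ : Z * x⁻¹ ∈ positive n) (hyZ : Z * y⁻¹ ∈ positive n) :
    ∃ L, IsCanonicalFactor L ∧ L * x⁻¹ ∈ positive n ∧ L * y⁻¹ ∈ positive n ∧
      Z * L⁻¹ ∈ positive n := by
  have key : ∀ {a b : BraidGroup n}, a * b⁻¹ ∈ positive n → (rev b)⁻¹ * rev a ∈ positive n :=
    fun h => by simpa only [rev_mul, rev_inv] using rev_mem_positive h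
  have key' : ∀ {a b : BraidGroup n}, b⁻¹ * a ∈ positive n → rev a * (rev b)⁻¹ ∈ positive n :=
    fun h => by simpa only [rev_mul, rev_inv] using rev_mem_positive h
  obtain ⟨L, hL, h₁, h₂, h₃⟩ := exists_canonical_right_multiple hn (hx.rev hn) (hy.rev hn)
    (rev_mem_positive hZ) (key hxZ) (key hyZ)
  have h₁ := key' h₁
  have h₂ := key' h₂
  have h₃ := key' h₃
  rw [rev_rev] at h₁ h₂ h₃
  exact ⟨rev L, hL.rev hn, h₁, h₂, h₃⟩

/-! ### Word length -/

theorem exists_exponentSum (n : ℕ) : ∃ φ : BraidGroup n →* Multiplicative ℤ,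
    ∀ i, 1 ≤ i → i < n → φ (sigma n i) = Multiplicative.ofAdd 1 := by
  obtain ⟨φ, hφ⟩ := exists_hom_of_artin (n := n) (fun _ => Multiplicative.ofAdd (1 : ℤ))
    (fun _ _ _ => rfl) (fun _ _ _ => rfl)
  exact ⟨φ, fun i h₁ h₂ => hφ i ⟨h₁, h₂⟩⟩

/-- The exponent sum of a braid. -/
noncomputable def exponentSum (g : BraidGroup n) : ℤ := ((exists_exponentSum n).choose g).toAdd

theorem exponentSum_mul (g h : BraidGroup n) :
    exponentSum (g * h) = exponentSum g + exponentSum h :=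
  congrArg Multiplicative.toAdd (map_mul _ g h)

theorem exponentSum_one : exponentSum (1 : BraidGroup n) = 0 :=
  congrArg Multiplicative.toAdd (map_one _)

theorem exponentSum_inv (g : BraidGroup n) : exponentSum g⁻¹ = -exponentSum g :=
  congrArg Multiplicative.toAdd (map_inv _ g)

theorem exponentSum_band {s t : ℕ} (hs : 1 ≤ s) (hst : s < t) (ht : t ≤ n) :
    exponentSum (band n t s) = 1 := by
  have h : exponentSum (sigma n s) = 1 := congrArg Multiplicative.toAdd
    ((exists_exponentSum n).choose_spec s hs (by omega))
  rw [band, exponentSum_mul, exponentSum_mul, exponentSum_inv, h]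
  ring

theorem exponentSum_prod {w : List (BraidGroup n)} (hw : ∀ a ∈ w, a ∈ bandGenerators n) :
    exponentSum w.prod = w.length := by
  induction w with
  | nil => exact exponentSum_one
  | cons a w ih =>
    obtain ⟨t, s, hs, hst, ht, rfl⟩ := hw a List.mem_cons_self
    rw [List.prod_cons, exponentSum_mul, exponentSum_band hs hst ht,
      ih fun a ha => hw a (List.mem_cons_of_mem _ ha), List.length_cons]
    push_cast
    ring

/-- Each band generator has exponent sum 1, so length becomes a homomorphism and lengths can be
compared additively. -/
theorem wordLength_eq {P : BraidGroup n} (hP : P ∈ positive n) :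
    (wordLength P : ℤ) = exponentSum P := by
  obtain ⟨w, hw, rfl⟩ := Submonoid.exists_list_of_mem_closure hP
  obtain ⟨w', hw', h, h'⟩ := Nat.sInf_mem (s := {k | ∃ v : List (BraidGroup n),
    (∀ a ∈ v, a ∈ bandGenerators n) ∧ v.prod = w.prod ∧ v.length = k}) ⟨_, w, hw, rfl, rfl⟩
  rw [← h, exponentSum_prod hw', h', h]
  rfl

theorem exponentSum_nonneg {P : BraidGroup n} (hP : P ∈ positive n) : 0 ≤ exponentSum P := by
  rw [← wordLength_eq hP]
  exact Int.natCast_nonneg _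

theorem exponentSum_lift_pos {u : NC n} (hu : u ≠ ⊥) : 0 < exponentSum (lift u) := by
  obtain ⟨s, t, hs, hst, ht, h⟩ := exists_rel_of_ne_bot hu
  rw [lift_eq hs hst ht h, exponentSum_mul, exponentSum_band hs hst ht]
  have := exponentSum_nonneg (lift_mem_positive (u ⊓ (atom s t hs hst ht).compl))
  omega

/-! ### Left-weighted decompositions -/

theorem IsCanonicalFactor.mem_positive {A : BraidGroup n} (hA : IsCanonicalFactor A) :
    A ∈ positive n := le_one_iff.1 hA.1

theorem IsCanonicalFactor.of_mul {P A Q : BraidGroup n} (h : IsCanonicalFactor (P * A * Q))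
    (hP : P ∈ positive n) (hA : A ∈ positive n) (hQ : Q ∈ positive n) : IsCanonicalFactor A := by
  obtain ⟨-, P₁, h₁, P₂, h₂, e⟩ := h
  refine ⟨le_one_iff.2 hA, P₁ * P, mul_mem h₁ hP, Q * P₂, mul_mem hQ h₂, ?_⟩
  rw [e]
  simp only [mul_assoc]

/-- A nontrivial S could be moved from P into A, giving a longer canonical factor. -/
theorem LeftWeighted.eq_one (hn : 1 ≤ n) {A P S : BraidGroup n} (h : LeftWeighted A P)
    (hS : S ∈ positive n) (hSP : S⁻¹ * P ∈ positive n) (hAS : IsCanonicalFactor (A * S)) :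
    S = 1 := by
  obtain ⟨hA, -, hmax⟩ := h
  have hA' := hA.mem_positive
  have hle := hmax (A * S) (S⁻¹ * P) hAS (le_one_iff.2 hSP) (by group)
  rw [← Int.ofNat_le, wordLength_eq hAS.mem_positive, wordLength_eq hA',
    exponentSum_mul] at hle
  obtain ⟨u, rfl⟩ := (isCanonicalFactor_iff hn).1
    (IsCanonicalFactor.of_mul (P := A) (Q := 1) (by rwa [mul_one]) hA' hS (one_mem _))
  by_contra hne
  have := exponentSum_lift_pos (u := u) (fun hu => hne (by rw [hu, lift_bot]))
  omega

/-- The common multiple of B and A dividing AP has the form AS with S dividing P, so S = 1. -/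
theorem LeftWeighted.dvd (hn : 1 ≤ n) {A P B : BraidGroup n} (h : LeftWeighted A P)
    (hB : IsCanonicalFactor B) (hBP : B⁻¹ * (A * P) ∈ positive n) : B⁻¹ * A ∈ positive n := by
  have hP := le_one_iff.1 h.2.1
  obtain ⟨L, hL, h₁, h₂, h₃⟩ := exists_canonical_right_multiple hn hB h.1
    (mul_mem h.1.mem_positive hP) hBP (by rwa [inv_mul_cancel_left])
  have e := h.eq_one hn h₂ (by simpa [mul_assoc] using h₃) (by rwa [mul_inv_cancel_left])
  rwa [inv_mul_eq_one.1 e]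

theorem leftWeighted_of_forall (hn : 1 ≤ n) {A P : BraidGroup n} (hA : IsCanonicalFactor A)
    (hP : P ∈ positive n)
    (h : ∀ S ∈ positive n, S⁻¹ * P ∈ positive n → IsCanonicalFactor (A * S) → S = 1) :
    LeftWeighted A P := by
  refine ⟨hA, le_one_iff.2 hP, fun B Q hB hQ e => ?_⟩
  rw [le_one_iff] at hQ
  obtain ⟨L, hL, h₁, h₂, h₃⟩ := exists_canonical_right_multiple hn hB hA
    (mul_mem hA.mem_positive hP) (by rwa [← e, inv_mul_cancel_left])
    (by rwa [inv_mul_cancel_left])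
  have e' := h _ h₂ (by simpa [mul_assoc] using h₃) (by rwa [mul_inv_cancel_left])
  rw [← inv_mul_eq_one.1 e'] at h₁
  have := exponentSum_nonneg h₁
  rw [exponentSum_mul, exponentSum_inv] at this
  rw [← Int.ofNat_le, wordLength_eq hB.mem_positive, wordLength_eq hA.mem_positive]
  omega

end Braid

/-! ### The three-factor argument. -/

/-- `A₀, A₁, A₂` are `A_{i-1}, A_i, A_{i+1}`; `A₁', A₂'` are `A_i', A_{i+1}'`; and
`A₀', A₁''` are `A_{i-1}', A_i''`. -/
theorem mainTheorem12 (n : ℕ) (hn : 1 ≤ n)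
    (A₀ A₁ A₂ A₁' A₂' A₀' A₁'' : Braid.BraidGroup n)
    (hA₀ : Braid.IsCanonicalFactor A₀) (hA₁ : Braid.IsCanonicalFactor A₁)
    (hA₂ : Braid.IsCanonicalFactor A₂)
    (h₀₁ : Braid.LeftWeighted A₀ A₁)
    (hA₁' : Braid.IsCanonicalFactor A₁') (hA₂' : Braid.IsCanonicalFactor A₂')
    (h₁₂ : A₁ * A₂ = A₁' * A₂')
    (h₁₂' : Braid.LeftWeighted A₁' A₂')
    (hA₀' : Braid.IsCanonicalFactor A₀') (hA₁'' : Braid.IsCanonicalFactor A₁'')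
    (h₀₁eq : A₀ * A₁' = A₀' * A₁'')
    (h₀₁' : Braid.LeftWeighted A₀' A₁'') :
    Braid.LeftWeighted A₁'' A₂' := by
  refine Braid.leftWeighted_of_forall hn hA₁'' hA₂'.mem_positive fun S hS hSA hAS => ?_
  have hc : A₀⁻¹ * A₀' ∈ Braid.positive n := h₀₁'.dvd hn hA₀
    (by rw [← h₀₁eq, inv_mul_cancel_left]; exact hA₁'.mem_positive)
  have hd : A₁⁻¹ * A₁' ∈ Braid.positive n := h₁₂'.dvd hn hA₁
    (by rw [← h₁₂, inv_mul_cancel_left]; exact hA₂.mem_positive)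
  obtain ⟨c, rfl⟩ : ∃ c, A₀' = A₀ * c := ⟨A₀⁻¹ * A₀', by group⟩
  obtain ⟨d, rfl⟩ : ∃ d, A₁' = A₁ * d := ⟨A₁⁻¹ * A₁', by group⟩
  rw [inv_mul_cancel_left] at hc hd
  rw [mul_assoc, mul_right_inj] at h₁₂ h₀₁eq
  have hdS : Braid.IsCanonicalFactor (d * S) := by
    refine Braid.IsCanonicalFactor.of_mul (P := 1) (Q := S⁻¹ * A₂') ?_ (one_mem _)
      (mul_mem hd hS) hSA
    rwa [show 1 * (d * S) * (S⁻¹ * A₂') = A₂ by rw [h₁₂]; group]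
  -- Two factorizations of Z, exhibiting dS and A₁''S as canonical right divisors.
  have hZ : A₁ * d * S = c * (A₁'' * S) := by rw [h₀₁eq, mul_assoc]
  obtain ⟨L, hL, hp, hq, hu⟩ := Braid.exists_canonical_left_multiple hn hdS hAS
    (mul_mem hA₁'.mem_positive hS) (by simpa [mul_assoc] using hA₁.mem_positive)
    (by rwa [hZ, mul_inv_cancel_right])
  -- With u = ZL⁻¹ one has u⁻¹A₁ = L(dS)⁻¹ and u⁻¹c = L(A₁''S)⁻¹.
  have hu₁ : (A₁ * d * S * L⁻¹)⁻¹ * A₁ ∈ Braid.positive n := by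
    convert hp using 1
    group
  have hu₂ : (A₁ * d * S * L⁻¹)⁻¹ * c ∈ Braid.positive n := by
    convert hq using 1
    rw [hZ]
    group
  have hAu : Braid.IsCanonicalFactor (A₀ * (A₁ * d * S * L⁻¹)) := by
    refine Braid.IsCanonicalFactor.of_mul (P := 1) (Q := (A₁ * d * S * L⁻¹)⁻¹ * c) ?_ (one_mem _)
      (mul_mem hA₀.mem_positive hu) hu₂
    rwa [one_mul, mul_assoc, mul_inv_cancel_left]
  -- u = 1, so A₁'S equals the canonical factor L.
  have e := mul_inv_eq_one.1 (h₀₁.eq_one hn hu hu₁ hAu)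
  exact h₁₂'.eq_one hn hS hSA (by rwa [e])
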